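/- Let $d\ge 2$ and let $C_1,C_2>0$. There is a constant $C>0$, depending only on $d$, $C_1$ and $C_2$, such that the following holds. Write $\pi_j(x)=(x_1,\dots,x_{j-1},x_{j+1},\dots,x_d)$ for $x\in\mathbb R^d$, $D_d=\partial_{x_1}\cdots\partial_{x_d}$, and $$\Lambda_d(f_1,\dots,f_d)=\int_{\mathbb R^d}e^{i\lambda S(x)}\,\psi(x)\prod_{j=1}^d f_j(\pi_j(x))\,dx .$$ Let $\lambda\in\mathbb R\setminus\{0\}$, $\mu>0$ and $b_1,\dots,b_d>0$. Let $\psi:\mathbb R^d\to\mathbb C$ be smooth and supported in a box of side lengths $b_1\times\cdots\times b_d$ with sides parallel to the coordinate axes. Let $K$ be the convex hull of $\operatorname{supp}\psi$ and let $S$ be a real-valued function that is smooth on an open set containing $K$. Suppose that $\Lambda_d$ satisfies the local estimate hypotheses in $x_1$ with parameter $\mu$ and constants $C_1,C_2$, that is, $$|\partial_{x_1}^m\psi(x)|\le C_1b_1^{-m}\qquad(m=0,1,2,\ x\in\mathbb R^d)$$ and $$|D_dS(x)|\ge\mu,\qquad |\partial_{x_1}D_dS(x)|\le C_2\,\mu\,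 b_1^{-1},\qquad |\partial_{x_1}^2D_dS(x)|\le C_2\,\mu\, b_1^{-2}\qquad(x\in K).$$ Let $(p_1,\dots,p_d)=(2^{d-1},2^{d-1},2^{d-2},\dots,4,2)$, that is, $p_1=2^{d-1}$ and $p_j=2^{d+1-j}$ for $2\le j\le d$. Then for all complex-valued $f_j\in L^{p_j}(\mathbb R^{d-1})$, $1\le j\le d$, the integral defining $\Lambda_d(f_1,\dots,f_d)$ converges absolutely and $$|\Lambda_d(f_1,\dots,f_d)|\le C\,(|\lambda|\mu)^{-2^{1-d}}\prod_{j=1}^d b_j^{\,1/p_j-2^{1-d}}\,\|f_j\|_{L^{p_j}(\mathbb R^{d-1})}.$$ -/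

import Mathlib

open MeasureTheory
open scoped ContDiff

/-- The partial derivative `∂_j g` of a function on `ℝ^d`. -/
noncomputable def partialDeriv {d : ℕ} {E : Type*} [NormedAddCommGroup E] [NormedSpace ℝ E]
    (j : Fin d) (g : (Fin d → ℝ) → E) : (Fin d → ℝ) → E :=
  fun x => lineDeriv ℝ g x (Pi.single j 1)

/-- The operator `D_d = ∂_1 ∂_2 ⋯ ∂_d`: one derivative in each coordinate. -/
noncomputable def mixedDeriv {d : ℕ} (S : (Fin d → ℝ) → ℝ) : (Fin d → ℝ) → ℝ :=
  (List.finRange d).foldr (fun j g => partialDeriv j g) S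

/-- The coordinate projection `π_j : ℝ^{n+1} → ℝ^n` that forgets the `j`-th coordinate. -/
def forgetCoord {n : ℕ} (j : Fin (n + 1)) (x : Fin (n + 1) → ℝ) : Fin n → ℝ :=
  fun k => x (j.succAbove k)

/-- The integrand `e^{iλS(x)} ψ(x) ∏_j f_j(π_j(x))`. -/
noncomputable def oscIntegrand {n : ℕ} (lam : ℝ) (S : (Fin (n + 1) → ℝ) → ℝ)
    (ψ : (Fin (n + 1) → ℝ) → ℂ) (f : Fin (n + 1) → (Fin n → ℝ) → ℂ)
    (x : Fin (n + 1) → ℝ) : ℂ :=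
  Complex.exp (Complex.I * lam * S x) * ψ x * ∏ j, f j (forgetCoord j x)

/-- The multilinear form `Λ_d(f_1, …, f_d)` in dimension `d = n + 1`. -/
noncomputable def oscForm {n : ℕ} (lam : ℝ) (S : (Fin (n + 1) → ℝ) → ℝ)
    (ψ : (Fin (n + 1) → ℝ) → ℂ) (f : Fin (n + 1) → (Fin n → ℝ) → ℂ) : ℂ :=
  ∫ x, oscIntegrand lam S ψ f x

/-- The local estimate hypotheses in the variable `x_j`, with parameter `μ`, for a phase `S` and a
cutoff `ψ` of width `w` in the direction `x_j`, with constants `C₁`, `C₂`. The conditions on the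
phase are imposed on the convex hull of the support of `ψ` (the support itself if it is convex). -/
structure LocalEstimateHypotheses {d : ℕ} (S : (Fin d → ℝ) → ℝ) (ψ : (Fin d → ℝ) → ℂ)
    (j : Fin d) (w μ C₁ C₂ : ℝ) : Prop where
  width : ∃ a : ℝ, ∀ x ∈ tsupport ψ, x j ∈ Set.Icc a (a + w)
  cutoff : ∀ m ≤ 2, ∀ x, ‖((partialDeriv j)^[m] ψ) x‖ ≤ C₁ / w ^ m
  phase_lower : ∀ x ∈ convexHull ℝ (tsupport ψ), μ ≤ |mixedDeriv S x|
  phase_first : ∀ x ∈ convexHull ℝ (tsupport ψ),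
    |partialDeriv j (mixedDeriv S) x| ≤ C₂ * μ / w
  phase_second : ∀ x ∈ convexHull ℝ (tsupport ψ),
    |partialDeriv j (partialDeriv j (mixedDeriv S)) x| ≤ C₂ * μ / w ^ 2

/-- The exponents `(p_1, …, p_d) = (2^{d-1}, 2^{d-1}, 2^{d-2}, …, 4, 2)`, with indices counted
from `0`: `p_1` is the value at `0`, and `p_{i+1} = 2^{d-i}` for `1 ≤ i ≤ d - 1`. -/
def offDiagExponent (d : ℕ) (j : Fin d) : ℕ :=
  if j.val = 0 then 2 ^ (d - 1) else 2 ^ (d - j.val)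

/-! The proof is by induction on the dimension, removing the last variable $y=x_d$ at each step. The
factor $f_d$ does not depend on $y$, so the form pairs $f_d\in L^2$ with $H(x)=\int F(x,y)\,dy$,
where $F$ collects everything else. By Cauchy–Schwarz it remains to bound $\|H\|_2^2$. Expanding the
square gives an integral over pairs $(y,y')$ of forms in dimension $d-1$, with phase
$S(\cdot,y)-S(\cdot,y')$, cutoff $\psi(\cdot,y)\overline{\psi(\cdot,y')}$ and functions
$f_j(\cdot,y)\overline{f_j(\cdot,y')}$ (`IsLocalDatum.enorm_oscForm_le_of_slices`).

By the mean value theorem in $y$, such a pair satisfies the same hypotheses with $\mu$ replaced by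
$\mu|y-y'|$, with the same $C_2$ and with $4C_1^2$ in place of $C_1$ (`IsLocalDatum.slice`). The
lower-dimensional bound thus yields a convolution kernel $k(y-y')$. Schur's test costs $2\int k$,
and Hölder's inequality in $y$ reassembles the norms of the $f_j$, because the exponents of
dimension $d-1$ have reciprocals summing to $1$ and double when the dimension rises.

For $d\ge 3$ the kernel is $|t|^{-2^{2-d}}$ on $|t|\le b_d$, which is integrable. For $d=2$ the same
recipe would give $|t|^{-1}$, which is not. The induction therefore starts at $d=2$, from the
sharper one-dimensional bound $b_1(1+(|\lambda|\mu b_1)^2)^{-1}$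
(`IsLocalDatum.norm_integral_amplitude_le`). It comes from two integrations by parts, which is why
two derivatives in $x_1$ are controlled. -/

open scoped ComplexConjugate ENNReal

/-! ### Calculus of partial derivatives on open sets -/

section Calculus

variable {d : ℕ} {E : Type*} [NormedAddCommGroup E] [NormedSpace ℝ E]

theorem partialDeriv_eqOn {U : Set (Fin d → ℝ)} (hU : IsOpen U) {g h : (Fin d → ℝ) → E}
    (hgh : Set.EqOn g h U) (j : Fin d) : Set.EqOn (partialDeriv j g) (partialDeriv j h) U :=
  fun _ hx => (hgh.eventuallyEq_of_mem (hU.mem_nhds hx)).lineDeriv_eq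

theorem partialDeriv_eq_fderiv {g : (Fin d → ℝ) → E} {x : Fin d → ℝ} (hg : DifferentiableAt ℝ g x)
    (j : Fin d) : partialDeriv j g x = fderiv ℝ g x (Pi.single j 1) :=
  hg.lineDeriv_eq_fderiv

theorem ContDiffOn.partialDeriv {U : Set (Fin d → ℝ)} (hU : IsOpen U) {g : (Fin d → ℝ) → E}
    (hg : ContDiffOn ℝ ∞ g U) (j : Fin d) : ContDiffOn ℝ ∞ (partialDeriv j g) U := by
  have h : ContDiffOn ℝ ∞ (fun x => fderiv ℝ g x (Pi.single j 1)) U :=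
    (hg.fderiv_of_isOpen hU (by simp)).clm_apply contDiffOn_const
  exact h.congr fun x hx =>
    partialDeriv_eq_fderiv ((hg.differentiableOn (by simp)).differentiableAt (hU.mem_nhds hx)) j

theorem ContDiff.partialDeriv {g : (Fin d → ℝ) → E} (hg : ContDiff ℝ ∞ g) (j : Fin d) :
    ContDiff ℝ ∞ (partialDeriv j g) :=
  contDiffOn_univ.1 (hg.contDiffOn.partialDeriv isOpen_univ j)

theorem partialDeriv_sub {U : Set (Fin d → ℝ)} (hU : IsOpen U) {g h : (Fin d → ℝ) → E}
    (hg : ContDiffOn ℝ ∞ g U) (hh : ContDiffOn ℝ ∞ h U) (j : Fin d) :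
    Set.EqOn (partialDeriv j (fun x => g x - h x))
      (fun x => partialDeriv j g x - partialDeriv j h x) U := by
  intro x hx
  have h1 := (hg.differentiableOn (by simp)).differentiableAt (hU.mem_nhds hx)
  have h2 := (hh.differentiableOn (by simp)).differentiableAt (hU.mem_nhds hx)
  simp only [partialDeriv_eq_fderiv h1, partialDeriv_eq_fderiv h2,
    partialDeriv_eq_fderiv (h1.fun_sub h2), fderiv_fun_sub h1 h2, sub_apply]

theorem partialDeriv_comm {U : Set (Fin d → ℝ)} (hU : IsOpen U) {g : (Fin d → ℝ) → E}
    (hg : ContDiffOn ℝ ∞ g U) (i j : Fin d) :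
    Set.EqOn (partialDeriv i (partialDeriv j g)) (partialDeriv j (partialDeriv i g)) U := by
  have key : ∀ i j : Fin d, ∀ x ∈ U, partialDeriv i (partialDeriv j g) x =
      fderiv ℝ (fderiv ℝ g) x (Pi.single i 1) (Pi.single j 1) := by
    intro i j x hx
    have h1 : Set.EqOn (partialDeriv j g) (fun x => fderiv ℝ g x (Pi.single j 1)) U := fun x hx =>
      partialDeriv_eq_fderiv ((hg.differentiableOn (by simp)).differentiableAt (hU.mem_nhds hx)) j
    have hd : ContDiffOn ℝ ∞ (fderiv ℝ g) U := hg.fderiv_of_isOpen hU (by simp)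
    have h2 := (hd.differentiableOn (by simp)).differentiableAt (hU.mem_nhds hx)
    rw [partialDeriv_eqOn hU h1 i hx,
      partialDeriv_eq_fderiv (h2.clm_apply (differentiableAt_const _)),
      fderiv_clm_apply h2 (differentiableAt_const _)]
    simp
  intro x hx
  rw [key i j x hx, key j i x hx]
  exact (hg.contDiffAt (hU.mem_nhds hx)).isSymmSndFDerivAt
    (by simpa using WithTop.coe_le_coe.2 (le_top : (2 : ℕ∞) ≤ ⊤)) _ _

/-- The iterated partial derivative along a list of coordinates, the last entry acting first. -/
noncomputable def iterPartialDeriv (l : List (Fin d)) (g : (Fin d → ℝ) → E) : (Fin d → ℝ) → E :=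
  l.foldr (fun j g => partialDeriv j g) g

theorem ContDiffOn.iterPartialDeriv {U : Set (Fin d → ℝ)} (hU : IsOpen U) {g : (Fin d → ℝ) → E}
    (hg : ContDiffOn ℝ ∞ g U) (l : List (Fin d)) : ContDiffOn ℝ ∞ (iterPartialDeriv l g) U := by
  induction l with
  | nil => exact hg
  | cons j l ih => exact ih.partialDeriv hU j

theorem iterPartialDeriv_sub {U : Set (Fin d → ℝ)} (hU : IsOpen U) {g h : (Fin d → ℝ) → E}
    (hg : ContDiffOn ℝ ∞ g U) (hh : ContDiffOn ℝ ∞ h U) (l : List (Fin d)) :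
    Set.EqOn (iterPartialDeriv l (fun x => g x - h x))
      (fun x => iterPartialDeriv l g x - iterPartialDeriv l h x) U := by
  induction l with
  | nil => exact fun _ _ => rfl
  | cons j l ih =>
    exact (partialDeriv_eqOn hU ih j).trans
      (partialDeriv_sub hU (hg.iterPartialDeriv hU l) (hh.iterPartialDeriv hU l) j)

theorem partialDeriv_iterPartialDeriv {U : Set (Fin d → ℝ)} (hU : IsOpen U)
    {g : (Fin d → ℝ) → E} (hg : ContDiffOn ℝ ∞ g U) (i : Fin d) (l : List (Fin d)) :
    Set.EqOn (partialDeriv i (iterPartialDeriv l g)) (iterPartialDeriv l (partialDeriv i g)) U := by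
  induction l with
  | nil => exact fun _ _ => rfl
  | cons j l ih =>
    exact (partialDeriv_comm hU (hg.iterPartialDeriv hU l) i j).trans (partialDeriv_eqOn hU ih j)

theorem hasDerivAt_comp_partialDeriv {g : (Fin d → ℝ) → E} {c : ℝ → Fin d → ℝ} {t : ℝ}
    {j : Fin d} (hg : DifferentiableAt ℝ g (c t)) (hc : HasDerivAt c (Pi.single j 1) t) :
    HasDerivAt (fun s => g (c s)) (partialDeriv j g (c t)) t := by
  rw [partialDeriv_eq_fderiv hg]
  exact hg.hasFDerivAt.comp_hasDerivAt t hc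

theorem partialDeriv_mul {g h : (Fin d → ℝ) → ℂ} (hg : ContDiff ℝ ∞ g) (hh : ContDiff ℝ ∞ h)
    (j : Fin d) : partialDeriv j (fun x => g x * h x) =
      fun x => partialDeriv j g x * h x + g x * partialDeriv j h x := by
  funext x
  have h1 : DifferentiableAt ℝ g x := hg.differentiable (by simp) x
  have h2 : DifferentiableAt ℝ h x := hh.differentiable (by simp) x
  rw [partialDeriv_eq_fderiv h1, partialDeriv_eq_fderiv h2,
    partialDeriv_eq_fderiv (h1.fun_mul h2), fderiv_fun_mul h1 h2]
  simp
  ring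

theorem partialDeriv_add {g h : (Fin d → ℝ) → ℂ} (hg : ContDiff ℝ ∞ g) (hh : ContDiff ℝ ∞ h)
    (j : Fin d) : partialDeriv j (fun x => g x + h x) =
      fun x => partialDeriv j g x + partialDeriv j h x := by
  funext x
  have h1 : DifferentiableAt ℝ g x := hg.differentiable (by simp) x
  have h2 : DifferentiableAt ℝ h x := hh.differentiable (by simp) x
  rw [partialDeriv_eq_fderiv h1, partialDeriv_eq_fderiv h2,
    partialDeriv_eq_fderiv (h1.fun_add h2), fderiv_fun_add h1 h2]
  simp

theorem partialDeriv_conj {g : (Fin d → ℝ) → ℂ} (hg : ContDiff ℝ ∞ g) (j : Fin d) :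
    partialDeriv j (fun x => conj (g x)) = fun x => conj (partialDeriv j g x) := by
  funext x
  have h1 : DifferentiableAt ℝ g x := hg.differentiable (by simp) x
  have h2 := (Complex.conjCLE.toContinuousLinearMap.hasFDerivAt (x := g x)).comp x h1.hasFDerivAt
  rw [partialDeriv_eq_fderiv h1]
  have h3 := partialDeriv_eq_fderiv h2.differentiableAt j
  rw [h2.fderiv] at h3
  exact h3

end Calculus

/-! ### Slices in the last coordinate -/

section Slices

/-- The point `(x, y)` of `ℝ^{n+1}` for `x ∈ ℝ^n` and `y ∈ ℝ`. -/
def appendCoord {n : ℕ} (x : Fin n → ℝ) (y : ℝ) : Fin (n + 1) → ℝ :=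
  Fin.snoc (α := fun _ => ℝ) x y

variable {n : ℕ}

@[simp] theorem appendCoord_castSucc (x : Fin n → ℝ) (y : ℝ) (j : Fin n) :
    appendCoord x y j.castSucc = x j := by simp [appendCoord]

@[simp] theorem appendCoord_last (x : Fin n → ℝ) (y : ℝ) :
    appendCoord x y (Fin.last n) = y := by simp [appendCoord]

theorem appendCoord_add_smul (x v : Fin n → ℝ) (y t s : ℝ) :
    appendCoord (x + t • v) (y + t * s) = appendCoord x y + t • appendCoord v s := by
  funext k
  refine Fin.lastCases ?_ (fun i => ?_) k <;> simp

theorem appendCoord_single (j : Fin n) :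
    appendCoord (Pi.single j 1) 0 = Pi.single j.castSucc (1 : ℝ) := by
  funext k
  refine Fin.lastCases ?_ (fun i => ?_) k
  · simp [(Fin.castSucc_lt_last j).ne']
  · simp [Pi.single_apply]

theorem contDiff_appendCoord (y : ℝ) : ContDiff ℝ ∞ (fun x : Fin n → ℝ => appendCoord x y) := by
  rw [contDiff_pi]
  intro k
  refine Fin.lastCases ?_ (fun i => ?_) k
  · simpa using contDiff_const
  · simpa using contDiff_apply ℝ ℝ i

theorem continuous_appendCoord :
    Continuous (fun p : (Fin n → ℝ) × ℝ => appendCoord p.1 p.2) := by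
  refine continuous_pi fun k => ?_
  refine Fin.lastCases ?_ (fun i => ?_) k
  · simpa using continuous_snd
  · simpa [Function.comp_def] using (continuous_apply i).comp continuous_fst

theorem hasDerivAt_appendCoord (x : Fin n → ℝ) (t : ℝ) :
    HasDerivAt (fun s => appendCoord x s) (Pi.single (Fin.last n) (1 : ℝ)) t := by
  rw [hasDerivAt_pi]
  intro k
  refine Fin.lastCases ?_ (fun i => ?_) k
  · simpa using hasDerivAt_id' t
  · simpa [Pi.single_apply, (Fin.castSucc_lt_last i).ne] using hasDerivAt_const t (x i)

theorem partialDeriv_appendCoord {E : Type*} [NormedAddCommGroup E] [NormedSpace ℝ E]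
    (g : (Fin (n + 1) → ℝ) → E) (y : ℝ) (j : Fin n) :
    partialDeriv j (fun x => g (appendCoord x y)) =
      fun x => partialDeriv j.castSucc g (appendCoord x y) := by
  funext x
  simp only [partialDeriv, lineDeriv, ← appendCoord_single, ← appendCoord_add_smul, mul_zero,
    add_zero]

theorem iterPartialDeriv_appendCoord {E : Type*} [NormedAddCommGroup E] [NormedSpace ℝ E]
    (g : (Fin (n + 1) → ℝ) → E) (y : ℝ) (l : List (Fin n)) :
    iterPartialDeriv l (fun x => g (appendCoord x y)) =
      fun x => iterPartialDeriv (l.map Fin.castSucc) g (appendCoord x y) := by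
  induction l with
  | nil => rfl
  | cons j l ih =>
    exact (congrArg (partialDeriv j) ih).trans (partialDeriv_appendCoord _ y j)

theorem mixedDeriv_succ (S : (Fin (n + 1) → ℝ) → ℝ) :
    mixedDeriv S = iterPartialDeriv ((List.finRange n).map Fin.castSucc)
      (partialDeriv (Fin.last n) S) := by
  simp [mixedDeriv, iterPartialDeriv, List.finRange_succ_last]

theorem convex_preimage_appendCoord {K : Set (Fin (n + 1) → ℝ)} (hK : Convex ℝ K) (y : ℝ) :
    Convex ℝ ((fun x => appendCoord x y) ⁻¹' K) := by
  intro x hx z hz s t hs ht hst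
  have h := hK hx hz hs ht hst
  have : appendCoord (s • x + t • z) y = s • appendCoord x y + t • appendCoord z y := by
    funext k
    refine Fin.lastCases ?_ (fun i => ?_) k
    · simp [← add_mul, hst]
    · simp
  simpa only [Set.mem_preimage, this] using h

theorem appendCoord_mem_of_mem_uIcc {K : Set (Fin (n + 1) → ℝ)} (hK : Convex ℝ K)
    {x : Fin n → ℝ} {y y' t : ℝ} (hy : appendCoord x y ∈ K) (hy' : appendCoord x y' ∈ K)
    (ht : t ∈ Set.uIcc y y') : appendCoord x t ∈ K := by
  rw [← segment_eq_uIcc] at ht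
  obtain ⟨r, s, hr, hs, hrs, rfl⟩ := ht
  have := hK hy hy' hr hs hrs
  convert this using 1
  funext k
  refine Fin.lastCases ?_ (fun i => ?_) k
  · simp
  · simp [← add_mul, hrs]

/-- Mean value theorem in the last coordinate. -/
theorem exists_sub_eq_partialDeriv_last {K U : Set (Fin (n + 1) → ℝ)} (hK : Convex ℝ K)
    (hU : IsOpen U) (hKU : K ⊆ U) {g : (Fin (n + 1) → ℝ) → ℝ} (hg : ContDiffOn ℝ ∞ g U)
    {x : Fin n → ℝ} {y y' : ℝ} (hy : appendCoord x y ∈ K) (hy' : appendCoord x y' ∈ K)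
    (hne : y ≠ y') : ∃ z ∈ K, |g (appendCoord x y) - g (appendCoord x y')| =
      |partialDeriv (Fin.last n) g z| * |y - y'| := by
  wlog hlt : y < y' generalizing y y'
  · obtain ⟨z, hz, h⟩ := this hy' hy hne.symm (lt_of_le_of_ne (not_lt.1 hlt) hne.symm)
    exact ⟨z, hz, by rw [abs_sub_comm, h, abs_sub_comm y' y]⟩
  have hmem : ∀ t ∈ Set.Icc y y', appendCoord x t ∈ K := fun t ht =>
    appendCoord_mem_of_mem_uIcc hK hy hy' (Set.Icc_subset_uIcc ht)
  have hder : ∀ t ∈ Set.Icc y y', HasDerivAt (fun s => g (appendCoord x s))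
      (partialDeriv (Fin.last n) g (appendCoord x t)) t := fun t ht =>
    hasDerivAt_comp_partialDeriv
      ((hg.differentiableOn (by simp)).differentiableAt (hU.mem_nhds (hKU (hmem t ht))))
      (hasDerivAt_appendCoord x t)
  obtain ⟨c, hc, h⟩ := exists_hasDerivAt_eq_slope (fun s => g (appendCoord x s)) _ hlt
    (fun t ht => (hder t ht).continuousAt.continuousWithinAt)
    (fun t ht => hder t (Set.Ioo_subset_Icc_self ht))
  refine ⟨_, hmem c (Set.Ioo_subset_Icc_self hc), ?_⟩
  rw [h, ← abs_mul, abs_sub_comm, abs_mul, abs_div, abs_sub_comm y y', div_mul_cancel₀]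
  exact abs_ne_zero.2 (sub_ne_zero.2 hlt.ne')

end Slices

/-! ### Inheritance of the hypotheses by pairs of slices -/

/-- The standing assumptions on the phase, the cutoff and the box `[a, a + b]`. -/
structure IsLocalDatum {n : ℕ} (S : (Fin (n + 1) → ℝ) → ℝ) (ψ : (Fin (n + 1) → ℝ) → ℂ)
    (a b : Fin (n + 1) → ℝ) (μ C₁ C₂ : ℝ) : Prop where
  smooth_cutoff : ContDiff ℝ ∞ ψ
  tsupport_subset : tsupport ψ ⊆ Set.Icc a (a + b)
  smooth_phase : ∃ U, IsOpen U ∧ convexHull ℝ (tsupport ψ) ⊆ U ∧ ContDiffOn ℝ ∞ S U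
  est : LocalEstimateHypotheses S ψ 0 (b 0) μ C₁ C₂

variable {n : ℕ}

theorem tsupport_slice_subset (ψ : (Fin (n + 1) → ℝ) → ℂ) (y y' : ℝ) :
    tsupport (fun x => ψ (appendCoord x y) * conj (ψ (appendCoord x y'))) ⊆
      (fun x => appendCoord x y) ⁻¹' tsupport ψ ∩ (fun x => appendCoord x y') ⁻¹' tsupport ψ := by
  have hc : ∀ y : ℝ, Continuous (fun x : Fin n → ℝ => appendCoord x y) := fun y =>
    (contDiff_appendCoord y).continuous
  refine closure_minimal ?_ (((isClosed_tsupport ψ).preimage (hc y)).inter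
    ((isClosed_tsupport ψ).preimage (hc y')))
  intro x hx
  have hx' : ψ (appendCoord x y) * conj (ψ (appendCoord x y')) ≠ 0 := hx
  constructor
  · exact subset_tsupport _ (left_ne_zero_of_mul hx')
  · refine subset_tsupport _ fun h => right_ne_zero_of_mul hx' ?_
    rw [h, map_zero]

/-- A point of the hull for the product cutoff lifts to two points of $K$ at heights $y$ and $y'$.
By convexity the segment joining them stays in $K$, so the mean value theorem bounds each difference
by the $y$-derivative at a point where the original hypotheses apply. This is where the convex hull
is needed, and why $C_2$ does not change. -/
theorem IsLocalDatum.slice {S : (Fin (n + 2) → ℝ) → ℝ} {ψ : (Fin (n + 2) → ℝ) → ℂ}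
    {a b : Fin (n + 2) → ℝ} {μ C₁ C₂ : ℝ} (h : IsLocalDatum S ψ a b μ C₁ C₂) (hb : 0 < b 0)
    {y y' : ℝ} (hy : y ≠ y') :
    IsLocalDatum (fun x => S (appendCoord x y) - S (appendCoord x y'))
      (fun x => ψ (appendCoord x y) * conj (ψ (appendCoord x y')))
      (fun j => a j.castSucc) (fun j => b j.castSucc) (μ * |y - y'|) (4 * C₁ ^ 2) C₂ := by
  obtain ⟨U, hU, hKU, hS⟩ := h.smooth_phase
  set K := convexHull ℝ (tsupport ψ) with hKdef
  have hK : Convex ℝ K := convex_convexHull ℝ _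
  have hts := tsupport_slice_subset ψ y y'
  have hbox : tsupport (fun x => ψ (appendCoord x y) * conj (ψ (appendCoord x y'))) ⊆
      Set.Icc (fun j : Fin (n + 1) => a j.castSucc)
        ((fun j : Fin (n + 1) => a j.castSucc) + fun j : Fin (n + 1) => b j.castSucc) := by
    intro x hx
    have hx1 := h.tsupport_subset (hts hx).1
    refine ⟨fun j => ?_, fun j => ?_⟩
    · simpa using hx1.1 j.castSucc
    · simpa using hx1.2 j.castSucc
  have hcon : convexHull ℝ (tsupport (fun x => ψ (appendCoord x y) *
      conj (ψ (appendCoord x y')))) ⊆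
      (fun x => appendCoord x y) ⁻¹' K ∩ (fun x => appendCoord x y') ⁻¹' K :=
    convexHull_min (hts.trans (Set.inter_subset_inter
      (Set.preimage_mono (subset_convexHull ℝ _)) (Set.preimage_mono (subset_convexHull ℝ _))))
      ((convex_preimage_appendCoord hK y).inter (convex_preimage_appendCoord hK y'))
  set V : Set (Fin (n + 1) → ℝ) :=
    (fun x => appendCoord x y) ⁻¹' U ∩ (fun x => appendCoord x y') ⁻¹' U with hV
  have hVo : IsOpen V := (hU.preimage (contDiff_appendCoord y).continuous).inter
    (hU.preimage (contDiff_appendCoord y').continuous)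
  have hKV : (fun x => appendCoord x y) ⁻¹' K ∩ (fun x => appendCoord x y') ⁻¹' K ⊆ V :=
    Set.inter_subset_inter (Set.preimage_mono hKU) (Set.preimage_mono hKU)
  have hsm : ∀ g : (Fin (n + 2) → ℝ) → ℝ, ContDiffOn ℝ ∞ g U →
      ContDiffOn ℝ ∞ (fun x => g (appendCoord x y)) V ∧
      ContDiffOn ℝ ∞ (fun x => g (appendCoord x y')) V := fun g hg =>
    ⟨hg.comp (contDiff_appendCoord y).contDiffOn fun x hx => hx.1,
      hg.comp (contDiff_appendCoord y').contDiffOn fun x hx => hx.2⟩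
  have hpsi : ∀ y : ℝ, ∀ g : (Fin (n + 2) → ℝ) → ℂ, ContDiff ℝ ∞ g →
      ContDiff ℝ ∞ (fun x => g (appendCoord x y)) := fun y g hg =>
    hg.comp (contDiff_appendCoord y)
  have hconj : ∀ g : (Fin (n + 1) → ℝ) → ℂ, ContDiff ℝ ∞ g → ContDiff ℝ ∞ (fun x => conj (g x)) :=
    fun g hg => Complex.conjCLE.contDiff.comp hg
  -- $T$ is the derivative of $S$ in all coordinates except the last. The mixed derivative of the
  -- sliced phase is a difference of values of $T$, and $\partial_{\mathrm{last}}T=D_dS$ once the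
  -- derivatives are commuted.
  set T := iterPartialDeriv ((List.finRange (n + 1)).map Fin.castSucc) S with hT
  have hTs : ContDiffOn ℝ ∞ T U := hS.iterPartialDeriv hU _
  have hTm : Set.EqOn (partialDeriv (Fin.last (n + 1)) T) (mixedDeriv S) U := by
    rw [mixedDeriv_succ]
    exact partialDeriv_iterPartialDeriv hU hS _ _
  have hmix : Set.EqOn (mixedDeriv fun x => S (appendCoord x y) - S (appendCoord x y'))
      (fun x => T (appendCoord x y) - T (appendCoord x y')) V := by
    have := iterPartialDeriv_sub hVo (hsm S hS).1 (hsm S hS).2 (List.finRange (n + 1))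
    simp only [iterPartialDeriv_appendCoord] at this
    exact this
  have hsub : ∀ g : (Fin (n + 2) → ℝ) → ℝ, ContDiffOn ℝ ∞ g U →
      Set.EqOn (partialDeriv 0 fun x => g (appendCoord x y) - g (appendCoord x y'))
      (fun x => partialDeriv 0 g (appendCoord x y) - partialDeriv 0 g (appendCoord x y')) V := by
    intro g hg
    have := partialDeriv_sub hVo (hsm g hg).1 (hsm g hg).2 0
    simpa only [partialDeriv_appendCoord, Fin.castSucc_zero] using this
  have hmix1 := (partialDeriv_eqOn hVo hmix 0).trans (hsub T hTs)
  have hmix2 := (partialDeriv_eqOn hVo hmix1 0).trans (hsub _ (hTs.partialDeriv hU 0))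
  have hT1 : Set.EqOn (partialDeriv (Fin.last (n + 1)) (partialDeriv 0 T))
      (partialDeriv 0 (mixedDeriv S)) U :=
    (partialDeriv_comm hU hTs _ _).trans (partialDeriv_eqOn hU hTm 0)
  have hT2 : Set.EqOn (partialDeriv (Fin.last (n + 1)) (partialDeriv 0 (partialDeriv 0 T)))
      (partialDeriv 0 (partialDeriv 0 (mixedDeriv S))) U :=
    (partialDeriv_comm hU (hTs.partialDeriv hU 0) _ _).trans (partialDeriv_eqOn hU hT1 0)
  have hpos : 0 < |y - y'| := abs_pos.2 (sub_ne_zero.2 hy)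
  have hψ := h.smooth_cutoff
  have hc0 : ∀ x, ‖ψ x‖ ≤ C₁ := fun x => by simpa using h.est.cutoff 0 (by norm_num) x
  have hc1 : ∀ x, ‖partialDeriv 0 ψ x‖ ≤ C₁ / b 0 := fun x => by
    simpa using h.est.cutoff 1 (by norm_num) x
  have hc2 : ∀ x, ‖partialDeriv 0 (partialDeriv 0 ψ) x‖ ≤ C₁ / b 0 ^ 2 := fun x => by
    simpa using h.est.cutoff 2 le_rfl x
  have hC : 0 ≤ C₁ := (norm_nonneg _).trans (hc0 0)
  have hprod : ∀ g k : (Fin (n + 2) → ℝ) → ℂ, ContDiff ℝ ∞ g → ContDiff ℝ ∞ k →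
      partialDeriv 0 (fun x => g (appendCoord x y) * conj (k (appendCoord x y'))) =
      fun x => partialDeriv 0 g (appendCoord x y) * conj (k (appendCoord x y')) +
        g (appendCoord x y) * conj (partialDeriv 0 k (appendCoord x y')) := by
    intro g k hg hk
    rw [partialDeriv_mul (hpsi y g hg) (hconj _ (hpsi y' k hk)), partialDeriv_appendCoord,
      partialDeriv_conj (hpsi y' k hk), partialDeriv_appendCoord]
    rfl
  refine ⟨(hpsi y ψ hψ).mul (hconj _ (hpsi y' ψ hψ)), hbox, ⟨V, hVo, hcon.trans hKV,
    (hsm S hS).1.sub (hsm S hS).2⟩, ⟨⟨a 0, fun x hx => ?_⟩, ?_, ?_, ?_, ?_⟩⟩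
  · have hx1 := hbox hx
    exact ⟨by simpa using hx1.1 0, by simpa using hx1.2 0⟩
  -- Leibniz produces $1$, $2$ and $4$ terms for $m=0,1,2$, each at most $C_1^2 b_0^{-m}$, so
  -- $4C_1^2$ serves all three.
  · intro m hm x
    have hψ1 := hψ.partialDeriv 0
    interval_cases m
    · simp only [Function.iterate_zero, id, norm_mul, RCLike.norm_conj, pow_zero, div_one]
      nlinarith [mul_le_mul (hc0 (appendCoord x y)) (hc0 (appendCoord x y')) (norm_nonneg _) hC]
    · simp only [Function.iterate_one, hprod ψ ψ hψ hψ, pow_one]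
      refine (norm_add_le _ _).trans ?_
      simp only [norm_mul, RCLike.norm_conj, Fin.castSucc_zero]
      have e1 := mul_le_mul (hc1 (appendCoord x y)) (hc0 (appendCoord x y')) (norm_nonneg _)
        (by positivity)
      have e2 := mul_le_mul (hc0 (appendCoord x y)) (hc1 (appendCoord x y')) (norm_nonneg _) hC
      have e3 : 0 ≤ C₁ ^ 2 / b 0 := by positivity
      calc _ ≤ C₁ / b 0 * C₁ + C₁ * (C₁ / b 0) := add_le_add e1 e2
        _ = 2 * (C₁ ^ 2 / b 0) := by ring
        _ ≤ 4 * (C₁ ^ 2 / b 0) := by linarith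
        _ = _ := by ring
    · simp only [Function.iterate_succ, Function.iterate_zero, Function.comp, id,
        hprod ψ ψ hψ hψ]
      rw [partialDeriv_add ((hpsi y _ hψ1).mul (hconj _ (hpsi y' ψ hψ)))
        ((hpsi y ψ hψ).mul (hconj _ (hpsi y' _ hψ1))), hprod _ _ hψ1 hψ, hprod _ _ hψ hψ1]
      refine (norm_add_le _ _).trans ((add_le_add (norm_add_le _ _) (norm_add_le _ _)).trans ?_)
      simp only [norm_mul, RCLike.norm_conj, Fin.castSucc_zero]
      have e1 := mul_le_mul (hc2 (appendCoord x y)) (hc0 (appendCoord x y')) (norm_nonneg _)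
        (by positivity)
      have e2 := mul_le_mul (hc1 (appendCoord x y)) (hc1 (appendCoord x y')) (norm_nonneg _)
        (by positivity)
      have e3 := mul_le_mul (hc0 (appendCoord x y)) (hc2 (appendCoord x y')) (norm_nonneg _) hC
      calc _ ≤ (C₁ / b 0 ^ 2 * C₁ + C₁ / b 0 * (C₁ / b 0)) +
            (C₁ / b 0 * (C₁ / b 0) + C₁ * (C₁ / b 0 ^ 2)) :=
            add_le_add (add_le_add e1 e2) (add_le_add e2 e3)
        _ = _ := by field_simp; ring
  · intro x hx
    have hx1 := hcon hx
    rw [hmix (hKV hx1)]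
    obtain ⟨z, hz, hz'⟩ := exists_sub_eq_partialDeriv_last hK hU hKU hTs hx1.1 hx1.2 hy
    rw [hz', hTm (hKU hz)]
    exact mul_le_mul_of_nonneg_right (h.est.phase_lower z hz) hpos.le
  · intro x hx
    have hx1 := hcon hx
    rw [hmix1 (hKV hx1)]
    obtain ⟨z, hz, hz'⟩ :=
      exists_sub_eq_partialDeriv_last hK hU hKU (hTs.partialDeriv hU 0) hx1.1 hx1.2 hy
    rw [hz', hT1 (hKU hz)]
    refine (mul_le_mul_of_nonneg_right (h.est.phase_first z hz) hpos.le).trans_eq ?_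
    simp only [Fin.castSucc_zero]
    ring
  · intro x hx
    have hx1 := hcon hx
    rw [hmix2 (hKV hx1)]
    obtain ⟨z, hz, hz'⟩ := exists_sub_eq_partialDeriv_last hK hU hKU
      ((hTs.partialDeriv hU 0).partialDeriv hU 0) hx1.1 hx1.2 hy
    rw [hz', hT2 (hKU hz)]
    refine (mul_le_mul_of_nonneg_right (h.est.phase_second z hz) hpos.le).trans_eq ?_
    simp only [Fin.castSucc_zero]
    ring

/-! ### Arithmetic of the exponents -/

section Exponents

theorem offDiagExponent_castSucc (n : ℕ) (j : Fin (n + 1)) :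
    offDiagExponent (n + 2) j.castSucc = 2 * offDiagExponent (n + 1) j := by
  have hj := j.isLt
  unfold offDiagExponent
  rw [Fin.val_castSucc]
  split_ifs
  · rw [← pow_succ']; congr 1
  · rw [← pow_succ']; congr 1; omega

theorem offDiagExponent_last (n : ℕ) : offDiagExponent (n + 2) (Fin.last (n + 1)) = 2 := by
  simp [offDiagExponent]

theorem offDiagExponent_pos (d : ℕ) (j : Fin d) : 0 < offDiagExponent d j := by
  unfold offDiagExponent
  split_ifs <;> positivity

theorem sum_inv_offDiagExponent (n : ℕ) :
    ∑ j : Fin (n + 1), (offDiagExponent (n + 1) j : ℝ)⁻¹ = 1 := by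
  induction n with
  | zero => simp [offDiagExponent]
  | succ n ih =>
    rw [Fin.sum_univ_castSucc, offDiagExponent_last]
    simp only [offDiagExponent_castSucc, Nat.cast_mul, mul_inv, ← Finset.mul_sum, ih]
    norm_num

theorem sum_inv_offDiagExponent_ennreal (n : ℕ) :
    ∑ j : Fin (n + 1), (offDiagExponent (n + 1) j : ℝ≥0∞)⁻¹ = 1 := by
  have h : ∀ j : Fin (n + 1), (offDiagExponent (n + 1) j : ℝ≥0∞)⁻¹ =
      ENNReal.ofReal (offDiagExponent (n + 1) j : ℝ)⁻¹ := fun j => by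
    rw [ENNReal.ofReal_inv_of_pos (by exact_mod_cast offDiagExponent_pos _ _),
      ENNReal.ofReal_natCast]
  simp only [h]
  rw [← ENNReal.ofReal_sum_of_nonneg (fun _ _ => by positivity), sum_inv_offDiagExponent,
    ENNReal.ofReal_one]

end Exponents

/-! ### Coordinate projections and the splitting of the measure -/

section Coordinates

variable {n : ℕ}

theorem forgetCoord_castSucc_appendCoord (j : Fin (n + 1)) (x : Fin (n + 1) → ℝ) (y : ℝ) :
    forgetCoord j.castSucc (appendCoord x y) = appendCoord (forgetCoord j x) y := by
  funext k
  refine Fin.lastCases ?_ (fun i => ?_) k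
  · have : j.castSucc.succAbove (Fin.last n) = Fin.last (n + 1) := by
      rw [Fin.succAbove_of_le_castSucc _ _ (Fin.castSucc_le_castSucc_iff.2 (Fin.le_last j)),
        Fin.succ_last]
    simp [forgetCoord, this]
  · simp [forgetCoord, Fin.castSucc_succAbove_castSucc]

theorem forgetCoord_last_appendCoord (x : Fin n → ℝ) (y : ℝ) :
    forgetCoord (Fin.last n) (appendCoord x y) = x := by
  funext k
  simp [forgetCoord]

/-- The measurable equivalence `(x, y) ↦ appendCoord x y`. -/
def appendCoordEquiv (n : ℕ) : (Fin n → ℝ) × ℝ ≃ᵐ (Fin (n + 1) → ℝ) :=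
  MeasurableEquiv.prodComm.trans
    (MeasurableEquiv.piFinSuccAbove (fun _ => ℝ) (Fin.last n)).symm

theorem coe_appendCoordEquiv :
    ⇑(appendCoordEquiv n) = fun p : (Fin n → ℝ) × ℝ => appendCoord p.1 p.2 := by
  funext p
  exact Fin.insertNth_last' (β := ℝ) p.2 p.1

theorem measurePreserving_appendCoordEquiv (n : ℕ) :
    MeasurePreserving (appendCoordEquiv n) (volume.prod volume) volume :=
  ((volume_preserving_piFinSuccAbove (fun _ => ℝ) (Fin.last n)).symm _).comp
    Measure.measurePreserving_swap

theorem measurable_appendCoord :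
    Measurable (fun p : (Fin n → ℝ) × ℝ => appendCoord p.1 p.2) :=
  continuous_appendCoord.measurable

theorem measurable_appendCoord_left (y : ℝ) :
    Measurable (fun x : Fin n → ℝ => appendCoord x y) :=
  measurable_appendCoord.comp (measurable_id.prodMk measurable_const)

theorem measurable_forgetCoord (j : Fin (n + 1)) :
    Measurable (forgetCoord j : (Fin (n + 1) → ℝ) → Fin n → ℝ) :=
  measurable_pi_lambda _ fun _ => measurable_pi_apply _

theorem quasiMeasurePreserving_forgetCoord (j : Fin (n + 1)) :
    Measure.QuasiMeasurePreserving (forgetCoord j : (Fin (n + 1) → ℝ) → Fin n → ℝ)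
      volume volume :=
  Measure.quasiMeasurePreserving_snd.comp
    (volume_preserving_piFinSuccAbove (fun _ => ℝ) j).quasiMeasurePreserving

/-- The composite is constant in $x_j$, so it is $p$-integrable only after $x_j$ is confined to a
bounded interval. -/
theorem MeasureTheory.MemLp.comp_forgetCoord {f : (Fin n → ℝ) → ℂ} {p : ℝ≥0∞}
    (hf : MemLp f p volume) (j : Fin (n + 1)) (a b : Fin (n + 1) → ℝ) :
    MemLp (fun x => f (forgetCoord j x)) p (volume.restrict (Set.Icc a b)) := by
  have h1 := hf.comp_snd (volume.restrict (Set.Icc (a j) (b j)))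
  rw [← Measure.restrict_univ (μ := (volume : Measure (Fin n → ℝ))), Measure.prod_restrict] at h1
  have h2 := h1.comp_measurePreserving
    ((volume_preserving_piFinSuccAbove (fun _ : Fin (n + 1) => ℝ) j).restrict_preimage
      (measurableSet_Icc.prod MeasurableSet.univ))
  refine MemLp.mono_measure (Measure.restrict_mono ?_ le_rfl) h2
  intro x hx
  exact ⟨⟨hx.1 j, hx.2 j⟩, trivial⟩

end Coordinates

/-! ### The amplitude and absolute convergence -/

section Amplitude

variable {n : ℕ} {S : (Fin (n + 1) → ℝ) → ℝ} {ψ : (Fin (n + 1) → ℝ) → ℂ}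
  {a b : Fin (n + 1) → ℝ} {μ C₁ C₂ : ℝ}

/-- The phase is controlled only on $U$, but the product vanishes off the support of $\psi$, which
lies in $U$. -/
theorem IsLocalDatum.continuous_amplitude (h : IsLocalDatum S ψ a b μ C₁ C₂) (lam : ℝ) :
    Continuous (fun x => Complex.exp (Complex.I * lam * S x) * ψ x) := by
  obtain ⟨U, hU, hKU, hS⟩ := h.smooth_phase
  refine ContinuousOn.continuous_of_tsupport_subset (s := U) ?_ hU ?_
  · refine ContinuousOn.mul ?_ h.smooth_cutoff.continuous.continuousOn
    exact Complex.continuous_exp.comp_continuousOn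
      (continuousOn_const.mul (Complex.continuous_ofReal.comp_continuousOn hS.continuousOn))
  · exact (closure_mono (Function.support_mul_subset_right _ _)).trans
      ((subset_convexHull ℝ _).trans hKU)

theorem norm_exp_I_mul (lam s : ℝ) : ‖Complex.exp (Complex.I * lam * s)‖ = 1 := by
  have : Complex.I * lam * s = ((lam * s : ℝ) : ℂ) * Complex.I := by push_cast; ring
  rw [this, Complex.norm_exp_ofReal_mul_I]

theorem IsLocalDatum.norm_cutoff_le (h : IsLocalDatum S ψ a b μ C₁ C₂) (x : Fin (n + 1) → ℝ) :
    ‖ψ x‖ ≤ C₁ := by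
  simpa using h.est.cutoff 0 (by norm_num) x

theorem IsLocalDatum.cutoff_eq_zero (h : IsLocalDatum S ψ a b μ C₁ C₂) {x : Fin (n + 1) → ℝ}
    (hx : x ∉ Set.Icc a (a + b)) : ψ x = 0 :=
  image_eq_zero_of_notMem_tsupport fun h' => hx (h.tsupport_subset h')

/-- Hölder's inequality on the box, extended by zero. It is used with all factors, giving $L^1$ and
absolute convergence, and with the last factor left out, giving $L^2$. -/
theorem IsLocalDatum.memLp_mul_prod (h : IsLocalDatum S ψ a b μ C₁ C₂) (lam : ℝ)
    {p : Fin (n + 1) → ℝ≥0∞} {f : Fin (n + 1) → (Fin n → ℝ) → ℂ} (s : Finset (Fin (n + 1)))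
    (hf : ∀ j ∈ s, MemLp (f j) (p j) volume) :
    MemLp (fun x => Complex.exp (Complex.I * lam * S x) * ψ x *
      ∏ j ∈ s, f j (forgetCoord j x)) (∑ j ∈ s, (p j)⁻¹)⁻¹ volume := by
  have h1 := MemLp.prod' (s := s) (fun j hj => (hf j hj).comp_forgetCoord j a (a + b))
  have h2 := MemLp.of_le_mul (c := C₁)
    (g := fun x => ∏ j ∈ s, f j (forgetCoord j x))
    (f := fun x => Complex.exp (Complex.I * lam * S x) * ψ x * ∏ j ∈ s, f j (forgetCoord j x)) h1
    (((h.continuous_amplitude lam).aestronglyMeasurable).fun_mul h1.1)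
    (Filter.Eventually.of_forall fun x => by
      rw [norm_mul, norm_mul, norm_exp_I_mul, one_mul]
      exact mul_le_mul_of_nonneg_right (h.norm_cutoff_le x) (norm_nonneg _))
  rw [← memLp_indicator_iff_restrict measurableSet_Icc] at h2
  convert h2 using 1
  refine (Set.indicator_eq_self.2 fun x hx => ?_).symm
  by_contra hx'
  exact hx (by simp [h.cutoff_eq_zero hx'])

theorem IsLocalDatum.integrable_oscIntegrand (h : IsLocalDatum S ψ a b μ C₁ C₂) (lam : ℝ)
    {f : Fin (n + 1) → (Fin n → ℝ) → ℂ}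
    (hf : ∀ j, MemLp (f j) (offDiagExponent (n + 1) j) volume) :
    Integrable (oscIntegrand lam S ψ f) volume := by
  have := h.memLp_mul_prod lam Finset.univ fun j _ => hf j
  rwa [sum_inv_offDiagExponent_ennreal, inv_one, memLp_one_iff_integrable] at this

end Amplitude

/-! ### Expanding the square and Schur's test -/

section Fubini

/-- Write $|\int h(x,y)\,dy|^2$ as a double integral over $(y,y')$ and integrate in $x$ first. The
absolute value is taken only after the $x$-integration, which preserves the oscillation. -/
theorem lintegral_enorm_integral_sq_le {X : Type*} [MeasurableSpace X] {ν : Measure X}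
    [SFinite ν] {h : X × ℝ → ℂ}
    (hint : Integrable (fun w : X × (ℝ × ℝ) => h (w.1, w.2.1) * conj (h (w.1, w.2.2)))
      (ν.prod (volume.prod volume))) :
    ∫⁻ x, ‖∫ y, h (x, y)‖ₑ ^ 2 ∂ν ≤
      ∫⁻ z : ℝ × ℝ, ‖∫ x, h (x, z.1) * conj (h (x, z.2)) ∂ν‖ₑ ∂(volume.prod volume) := by
  set H : X → ℂ := fun x => ∫ y, h (x, y) with hH
  have h1 : ∀ x, ∫ z : ℝ × ℝ, h (x, z.1) * conj (h (x, z.2)) ∂(volume.prod volume) =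
      ((‖H x‖ ^ 2 : ℝ) : ℂ) := fun x => by
    rw [integral_prod_mul (fun y => h (x, y)) (fun y => conj (h (x, y))), integral_conj,
      Complex.mul_conj, Complex.normSq_eq_norm_sq]
  have h2 : Integrable (fun x => ((‖H x‖ ^ 2 : ℝ) : ℂ)) ν := by
    simpa only [h1] using hint.integral_prod_left
  have h3 : Integrable (fun x => ‖H x‖ ^ 2) ν := by
    simpa [← Complex.ofReal_pow] using h2.re
  have h4 : ∫⁻ x, ‖H x‖ₑ ^ 2 ∂ν = ‖∫ x, ((‖H x‖ ^ 2 : ℝ) : ℂ) ∂ν‖ₑ := by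
    rw [integral_complex_ofReal, ← ofReal_norm, Complex.norm_real,
      Real.norm_of_nonneg (integral_nonneg fun _ => by positivity),
      ofReal_integral_eq_lintegral_ofReal h3 (Filter.Eventually.of_forall fun _ => by positivity)]
    simp_rw [ENNReal.ofReal_pow (norm_nonneg _), ofReal_norm]
  rw [h4]
  simp_rw [← h1]
  rw [integral_integral_swap hint]
  exact enorm_integral_le_lintegral_enorm _

theorem ENNReal.mul_le_sq_add_sq (a b : ℝ≥0∞) : a * b ≤ a ^ 2 + b ^ 2 := by
  rcases le_total a b with h | h
  · calc a * b ≤ b * b := by gcongr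
      _ ≤ a ^ 2 + b ^ 2 := by rw [← sq]; exact le_add_self
  · calc a * b ≤ a * a := by gcongr
      _ ≤ a ^ 2 + b ^ 2 := by rw [← sq]; exact le_self_add

/-- Schur's test for a convolution kernel. -/
theorem lintegral_convolution_form_le {k G : ℝ → ℝ≥0∞} (hk : Measurable k) (hG : Measurable G) :
    ∫⁻ z : ℝ × ℝ, k (z.1 - z.2) * (G z.1 * G z.2) ∂(volume.prod volume) ≤
      2 * (∫⁻ t, k t) * ∫⁻ y, G y ^ 2 := by
  have hk' : Measurable fun z : ℝ × ℝ => k (z.1 - z.2) :=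
    hk.comp (measurable_fst.sub measurable_snd)
  have m1 : Measurable fun z : ℝ × ℝ => k (z.1 - z.2) * G z.1 ^ 2 :=
    hk'.mul ((hG.comp measurable_fst).pow_const 2)
  have m2 : Measurable fun z : ℝ × ℝ => k (z.1 - z.2) * G z.2 ^ 2 :=
    hk'.mul ((hG.comp measurable_snd).pow_const 2)
  have e1 : ∫⁻ z : ℝ × ℝ, k (z.1 - z.2) * G z.1 ^ 2 ∂(volume.prod volume) =
      (∫⁻ t, k t) * ∫⁻ y, G y ^ 2 := by
    rw [lintegral_prod _ m1.aemeasurable, ← lintegral_const_mul _ (hG.pow_const 2)]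
    refine lintegral_congr fun y => ?_
    have hm : Measurable fun t => k (y - t) := hk.comp (measurable_const.sub measurable_id)
    dsimp only
    rw [lintegral_mul_const _ hm,
      lintegral_sub_left_eq_self k y]
  have e2 : ∫⁻ z : ℝ × ℝ, k (z.1 - z.2) * G z.2 ^ 2 ∂(volume.prod volume) =
      (∫⁻ t, k t) * ∫⁻ y, G y ^ 2 := by
    rw [lintegral_prod_symm _ m2.aemeasurable, ← lintegral_const_mul _ (hG.pow_const 2)]
    refine lintegral_congr fun y => ?_
    have hm : Measurable fun t => k (t - y) := hk.comp (measurable_id.sub measurable_const)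
    dsimp only
    rw [lintegral_mul_const _ hm,
      lintegral_sub_right_eq_self k y]
  calc _ ≤ ∫⁻ z : ℝ × ℝ, (k (z.1 - z.2) * G z.1 ^ 2 + k (z.1 - z.2) * G z.2 ^ 2)
        ∂(volume.prod volume) := by
        refine lintegral_mono fun z => ?_
        rw [← mul_add]
        gcongr
        exact ENNReal.mul_le_sq_add_sq _ _
    _ = _ := by rw [lintegral_add_left m1, e1, e2]; ring

/-- Since $|h(x,y)h(x,y')|$ is at most the sum of the two squares, and both $y,y'$ may be restricted
to $I$, the integral is at most $2|I|\,\|h\|_2^2$. This justifies Fubini in the expanded square. -/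
theorem integrable_mul_conj_of_memLp_two {X : Type*} [MeasurableSpace X] {ν : Measure X}
    [SFinite ν] {h : X × ℝ → ℂ} (hm : Measurable h) (hL : MemLp h 2 (ν.prod volume))
    {I : Set ℝ} (hI : MeasurableSet I) (hIfin : volume I ≠ ⊤) (hsupp : ∀ x, ∀ y ∉ I, h (x, y) = 0) :
    Integrable (fun w : X × (ℝ × ℝ) => h (w.1, w.2.1) * conj (h (w.1, w.2.2)))
      (ν.prod (volume.prod volume)) := by
  have hx : ∀ x, Measurable fun y => ‖h (x, y)‖ₑ ^ 2 := fun x =>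
    (hm.comp (measurable_const.prodMk measurable_id)).enorm.pow_const 2
  have m1 : Measurable fun w : X × (ℝ × ℝ) => h (w.1, w.2.1) := by fun_prop
  have m2 : Measurable fun w : X × (ℝ × ℝ) => h (w.1, w.2.2) := by fun_prop
  have mc : Measurable fun w : X × (ℝ × ℝ) => conj (h (w.1, w.2.2)) :=
    Complex.continuous_conj.measurable.comp m2
  refine ⟨(m1.mul mc).aestronglyMeasurable, ?_⟩
  have hfin : ∫⁻ x, (∫⁻ y, ‖h (x, y)‖ₑ ^ 2) ∂ν < ⊤ := by
    rw [← lintegral_prod _ (hm.enorm.pow_const 2).aemeasurable]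
    have := (lintegral_rpow_enorm_lt_top_of_eLpNorm_lt_top two_ne_zero (by simp) hL.2)
    simpa using this
  rw [hasFiniteIntegral_iff_enorm, lintegral_prod _ (m1.fun_mul mc).enorm.aemeasurable]
  set J : ℝ → ℝ≥0∞ := I.indicator 1 with hJ
  have hJm : Measurable J := measurable_one.indicator hI
  have hJint : ∫⁻ y, J y = volume I := lintegral_indicator_one hI
  have key : ∀ x, ∫⁻ z : ℝ × ℝ, ‖h (x, z.1) * conj (h (x, z.2))‖ₑ ∂(volume.prod volume) ≤
      2 * volume I * ∫⁻ y, ‖h (x, y)‖ₑ ^ 2 := by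
    intro x
    calc _ ≤ ∫⁻ z : ℝ × ℝ, (‖h (x, z.1)‖ₑ ^ 2 * J z.2 + J z.1 * ‖h (x, z.2)‖ₑ ^ 2)
          ∂(volume.prod volume) := by
          refine lintegral_mono fun z => ?_
          dsimp only
          by_cases h1 : z.1 ∈ I
          · by_cases h2 : z.2 ∈ I
            · have e : ‖conj (h (x, z.2))‖ₑ = ‖h (x, z.2)‖ₑ := by
                rw [← ofReal_norm, RCLike.norm_conj, ofReal_norm]
              rw [enorm_mul, e, hJ, Set.indicator_of_mem h1, Set.indicator_of_mem h2]
              simpa using ENNReal.mul_le_sq_add_sq _ _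
            · simp [hsupp x _ h2]
          · simp [hsupp x _ h1]
      _ = _ := by
          have hm1 : Measurable fun z : ℝ × ℝ => ‖h (x, z.1)‖ₑ ^ 2 * J z.2 :=
            ((hx x).comp measurable_fst).mul (hJm.comp measurable_snd)
          rw [lintegral_add_left hm1,
            lintegral_prod_mul (hx x).aemeasurable hJm.aemeasurable,
            lintegral_prod_mul hJm.aemeasurable (hx x).aemeasurable, hJint]
          ring
  refine (lintegral_mono key).trans_lt ?_
  rw [lintegral_const_mul' _ _ (ENNReal.mul_ne_top (by simp) hIfin)]
  exact ENNReal.mul_lt_top (ENNReal.mul_lt_top (by simp) hIfin.lt_top) hfin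

end Fubini

/-! ### Norms of slices -/

section SliceNorms

variable {n : ℕ}

theorem eLpNorm_natCast_eq {X : Type*} [MeasurableSpace X] {ν : Measure X} (f : X → ℂ) {m : ℕ}
    (hm : 0 < m) : eLpNorm f m ν = (∫⁻ x, ‖f x‖ₑ ^ m ∂ν) ^ (m : ℝ)⁻¹ := by
  rw [eLpNorm_eq_lintegral_rpow_enorm_toReal (by exact_mod_cast hm.ne') (ENNReal.natCast_ne_top m)]
  simp

theorem measurable_lintegral_slice {g : (Fin (n + 1) → ℝ) → ℝ≥0∞} (hg : Measurable g) :
    Measurable fun y => ∫⁻ x, g (appendCoord x y) :=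
  (hg.comp measurable_appendCoord).lintegral_prod_left'

theorem lintegral_lintegral_slice {g : (Fin (n + 1) → ℝ) → ℝ≥0∞} (hg : Measurable g) :
    ∫⁻ y, ∫⁻ x, g (appendCoord x y) = ∫⁻ x, g x := by
  rw [← (measurePreserving_appendCoordEquiv n).lintegral_comp hg, coe_appendCoordEquiv]
  exact (lintegral_prod_symm _ (hg.comp measurable_appendCoord).aemeasurable).symm

theorem measurable_eLpNorm_slice {f : (Fin (n + 1) → ℝ) → ℂ} (hf : Measurable f) {m : ℕ}
    (hm : 0 < m) : Measurable fun y => eLpNorm (fun x => f (appendCoord x y)) m volume := by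
  simp only [eLpNorm_natCast_eq _ hm]
  exact (measurable_lintegral_slice (hf.enorm.pow_const m)).pow_const _

theorem ae_memLp_slice {f : (Fin (n + 1) → ℝ) → ℂ} (hf : Measurable f) {m : ℕ} (hm : 0 < m)
    (hL : MemLp f m volume) : ∀ᵐ y : ℝ, MemLp (fun x => f (appendCoord x y)) m volume := by
  have hm0 : (m : ℝ≥0∞) ≠ 0 := by exact_mod_cast hm.ne'
  have h1 : ∫⁻ y, ∫⁻ x, ‖f (appendCoord x y)‖ₑ ^ m < ⊤ := by
    rw [lintegral_lintegral_slice (hf.enorm.pow_const m)]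
    simpa using lintegral_rpow_enorm_lt_top_of_eLpNorm_lt_top hm0 (ENNReal.natCast_ne_top m) hL.2
  filter_upwards [ae_lt_top (measurable_lintegral_slice (hf.enorm.pow_const m)) h1.ne] with y hy
  refine ⟨(hf.comp (measurable_appendCoord_left y)).aestronglyMeasurable, ?_⟩
  rw [eLpNorm_natCast_eq _ hm]
  exact ENNReal.rpow_lt_top_of_nonneg (by positivity) hy.ne

theorem eLpNorm_two_mul_sq {X : Type*} [MeasurableSpace X] {ν : Measure X} (f : X → ℂ) {q : ℕ}
    (hq : 0 < q) :
    eLpNorm f ((2 * q : ℕ) : ℝ≥0∞) ν ^ 2 = (∫⁻ x, ‖f x‖ₑ ^ (2 * q) ∂ν) ^ (q : ℝ)⁻¹ := by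
  rw [eLpNorm_natCast_eq _ (by positivity), ← ENNReal.rpow_natCast, ← ENNReal.rpow_mul]
  congr 1
  push_cast
  have : (q : ℝ) ≠ 0 := by positivity
  field_simp

/-- The square of a slice norm in $L^{2q_j}$ is the $1/q_j$ power of a function whose $y$-integral
is $\|f_j\|_{2q_j}^{2q_j}$; Hölder with weights $1/q_j$ then applies. -/
theorem lintegral_prod_eLpNorm_slice_sq_le {ι : Type*} [Fintype ι] {q : ι → ℕ}
    (hq : ∀ j, 0 < q j) (hsum : ∑ j, (q j : ℝ)⁻¹ = 1) {f : ι → (Fin (n + 1) → ℝ) → ℂ}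
    (hf : ∀ j, Measurable (f j)) :
    ∫⁻ y, (∏ j, eLpNorm (fun x => f j (appendCoord x y)) ((2 * q j : ℕ) : ℝ≥0∞) volume) ^ 2 ≤
      (∏ j, eLpNorm (f j) ((2 * q j : ℕ) : ℝ≥0∞) volume) ^ 2 := by
  simp only [← Finset.prod_pow, eLpNorm_two_mul_sq _ (hq _)]
  refine (ENNReal.lintegral_prod_norm_pow_le Finset.univ
    (fun j _ => (measurable_lintegral_slice ((hf j).enorm.pow_const _)).aemeasurable) hsum
    (fun j _ => by positivity)).trans_eq ?_
  simp only [lintegral_lintegral_slice ((hf _).enorm.pow_const _)]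

theorem holderTriple_two_mul (q : ℕ) :
    ENNReal.HolderTriple ((2 * q : ℕ) : ℝ≥0∞) ((2 * q : ℕ) : ℝ≥0∞) (q : ℝ≥0∞) := by
  refine ⟨?_⟩
  push_cast
  rw [ENNReal.mul_inv (by simp) (by simp), ← add_mul, ENNReal.inv_two_add_inv_two, one_mul]

theorem MeasureTheory.MemLp.mul_conj {X : Type*} [MeasurableSpace X] {ν : Measure X}
    {f g : X → ℂ} {q : ℕ} (hf : MemLp f ((2 * q : ℕ) : ℝ≥0∞) ν)
    (hg : MemLp g ((2 * q : ℕ) : ℝ≥0∞) ν) : MemLp (fun x => f x * conj (g x)) q ν := by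
  have := holderTriple_two_mul q
  exact hg.star.mul hf

theorem eLpNorm_mul_conj_le {X : Type*} [MeasurableSpace X] {ν : Measure X}
    {f g : X → ℂ} {q : ℕ} (hf : MemLp f ((2 * q : ℕ) : ℝ≥0∞) ν)
    (hg : MemLp g ((2 * q : ℕ) : ℝ≥0∞) ν) :
    eLpNorm (fun x => f x * conj (g x)) q ν ≤
      eLpNorm f ((2 * q : ℕ) : ℝ≥0∞) ν * eLpNorm g ((2 * q : ℕ) : ℝ≥0∞) ν := by
  have := holderTriple_two_mul q
  have h1 : eLpNorm (star g) ((2 * q : ℕ) : ℝ≥0∞) ν = eLpNorm g ((2 * q : ℕ) : ℝ≥0∞) ν :=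
    eLpNorm_congr_norm_ae (Filter.Eventually.of_forall fun x => norm_star _)
  have h2 := eLpNorm_smul_le_mul_eLpNorm (p := ((2 * q : ℕ) : ℝ≥0∞))
    (q := ((2 * q : ℕ) : ℝ≥0∞)) (r := (q : ℝ≥0∞)) hg.star.1 hf.1
  rwa [h1] at h2

end SliceNorms

/-! ### The Cauchy–Schwarz step -/

section CauchySchwarz

variable {n : ℕ}

theorem exp_mul_conj_exp (lam s s' : ℝ) :
    Complex.exp (Complex.I * lam * s) * conj (Complex.exp (Complex.I * lam * s')) =
      Complex.exp (Complex.I * lam * ((s - s' : ℝ) : ℂ)) := by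
  rw [← Complex.exp_conj, ← Complex.exp_add]
  congr 1
  simp
  ring

theorem oscIntegrand_slice (lam : ℝ) (S : (Fin (n + 2) → ℝ) → ℝ) (ψ : (Fin (n + 2) → ℝ) → ℂ)
    (f : Fin (n + 1) → (Fin (n + 1) → ℝ) → ℂ) (x : Fin (n + 1) → ℝ) (y y' : ℝ) :
    oscIntegrand lam (fun x => S (appendCoord x y) - S (appendCoord x y'))
      (fun x => ψ (appendCoord x y) * conj (ψ (appendCoord x y')))
      (fun j x => f j (appendCoord x y) * conj (f j (appendCoord x y'))) x =
    (Complex.exp (Complex.I * lam * S (appendCoord x y)) * ψ (appendCoord x y) *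
      ∏ j, f j (appendCoord (forgetCoord j x) y)) *
    conj (Complex.exp (Complex.I * lam * S (appendCoord x y')) * ψ (appendCoord x y') *
      ∏ j, f j (appendCoord (forgetCoord j x) y')) := by
  rw [oscIntegrand, Finset.prod_mul_distrib, ← exp_mul_conj_exp, map_mul, map_mul, map_prod]
  ring

theorem oscIntegrand_appendCoord (lam : ℝ) (S : (Fin (n + 2) → ℝ) → ℝ)
    (ψ : (Fin (n + 2) → ℝ) → ℂ) (f : Fin (n + 2) → (Fin (n + 1) → ℝ) → ℂ)
    (x : Fin (n + 1) → ℝ) (y : ℝ) :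
    oscIntegrand lam S ψ f (appendCoord x y) = f (Fin.last (n + 1)) x *
      (Complex.exp (Complex.I * lam * S (appendCoord x y)) * ψ (appendCoord x y) *
        ∏ j : Fin (n + 1), f j.castSucc (appendCoord (forgetCoord j x) y)) := by
  rw [oscIntegrand, Fin.prod_univ_castSucc, forgetCoord_last_appendCoord]
  simp only [forgetCoord_castSucc_appendCoord]
  ring

/-- One Cauchy–Schwarz step: if the forms on pairs of slices are controlled by a convolution
kernel, then so is the form itself. -/
theorem IsLocalDatum.enorm_oscForm_le_of_slices {S : (Fin (n + 2) → ℝ) → ℝ}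
    {ψ : (Fin (n + 2) → ℝ) → ℂ} {a b : Fin (n + 2) → ℝ} {μ C₁ C₂ : ℝ}
    (h : IsLocalDatum S ψ a b μ C₁ C₂) (lam : ℝ) {f : Fin (n + 2) → (Fin (n + 1) → ℝ) → ℂ}
    (hf : ∀ j, Measurable (f j)) (hL : ∀ j, MemLp (f j) (offDiagExponent (n + 2) j) volume)
    {k : ℝ → ℝ≥0∞} (hk : Measurable k)
    (hslice : ∀ y y' : ℝ, y ≠ y' →
      (∀ j : Fin (n + 1), MemLp (fun x => f j.castSucc (appendCoord x y) *
        conj (f j.castSucc (appendCoord x y'))) (offDiagExponent (n + 1) j) volume) →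
      ‖oscForm lam (fun x => S (appendCoord x y) - S (appendCoord x y'))
        (fun x => ψ (appendCoord x y) * conj (ψ (appendCoord x y')))
        (fun (j : Fin (n + 1)) x => f j.castSucc (appendCoord x y) *
          conj (f j.castSucc (appendCoord x y')))‖ₑ ≤
      k (y - y') * ∏ j : Fin (n + 1), eLpNorm (fun x => f j.castSucc (appendCoord x y) *
        conj (f j.castSucc (appendCoord x y'))) (offDiagExponent (n + 1) j) volume) :
    ‖oscForm lam S ψ f‖ₑ ≤ (2 * ∫⁻ t, k t) ^ (1 / 2 : ℝ) *
      ∏ j, eLpNorm (f j) (offDiagExponent (n + 2) j) volume := by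
  set q : Fin (n + 1) → ℕ := offDiagExponent (n + 1) with hqdef
  have hq : ∀ j, 0 < q j := offDiagExponent_pos _
  have hpq : ∀ j : Fin (n + 1), offDiagExponent (n + 2) j.castSucc = 2 * q j :=
    offDiagExponent_castSucc n
  set g : Fin (n + 1) → (Fin (n + 1) → ℝ) → ℂ := fun j => f j.castSucc with hg
  have hgm : ∀ j, Measurable (g j) := fun j => hf _
  have hgL : ∀ j, MemLp (g j) ((2 * q j : ℕ) : ℝ≥0∞) volume := fun j => by
    simpa only [hpq] using hL j.castSucc
  set F : (Fin (n + 1) → ℝ) × ℝ → ℂ := fun p =>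
    Complex.exp (Complex.I * lam * S (appendCoord p.1 p.2)) * ψ (appendCoord p.1 p.2) *
      ∏ j : Fin (n + 1), g j (appendCoord (forgetCoord j p.1) p.2) with hF
  have hFm : Measurable F := by
    refine ((h.continuous_amplitude lam).measurable.comp measurable_appendCoord).mul ?_
    refine Finset.measurable_prod _ fun j _ => (hgm j).comp ?_
    exact measurable_appendCoord.comp
      (((measurable_forgetCoord j).comp measurable_fst).prodMk measurable_snd)
  -- Without the last function, the reciprocal exponents sum to $\sum_j 1/(2q_j)=1/2$.
  have hFL : MemLp F 2 (volume.prod volume) := by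
    have h1 := h.memLp_mul_prod lam (Finset.univ.map Fin.castSuccEmb) (f := f)
      (p := fun j => (offDiagExponent (n + 2) j : ℝ≥0∞)) fun j _ => hL j
    have h2 := h1.comp_measurePreserving (measurePreserving_appendCoordEquiv (n + 1))
    have h3 : ∑ j : Fin (n + 1), ((2 * q j : ℕ) : ℝ≥0∞)⁻¹ = 2⁻¹ := by
      simp only [Nat.cast_mul, Nat.cast_ofNat]
      simp only [ENNReal.mul_inv (Or.inl two_ne_zero) (Or.inl ENNReal.ofNat_ne_top)]
      rw [← Finset.mul_sum, sum_inv_offDiagExponent_ennreal, mul_one]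
    simp only [Finset.sum_map, Fin.coe_castSuccEmb, hpq, h3, inv_inv] at h2
    convert h2 using 1
    funext p
    simp only [hF, Function.comp, coe_appendCoordEquiv, Finset.prod_map, Fin.coe_castSuccEmb,
      forgetCoord_castSucc_appendCoord, hg]
  have hsupp : ∀ x, ∀ y ∉ Set.Icc (a (Fin.last (n + 1))) ((a + b) (Fin.last (n + 1))),
      F (x, y) = 0 := by
    intro x y hy
    have : ψ (appendCoord x y) = 0 := h.cutoff_eq_zero fun hx => hy
      ⟨by simpa using hx.1 (Fin.last _), by simpa using hx.2 (Fin.last _)⟩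
    simp [hF, this]
  have hint := integrable_mul_conj_of_memLp_two hFm hFL measurableSet_Icc
    (by simp [Real.volume_Icc]) hsupp
  have hosc : oscForm lam S ψ f = ∫ x, f (Fin.last (n + 1)) x * ∫ y, F (x, y) := by
    have hi := (measurePreserving_appendCoordEquiv (n + 1)).integrable_comp_emb
      (appendCoordEquiv (n + 1)).measurableEmbedding |>.2 (h.integrable_oscIntegrand lam hL)
    rw [oscForm, ← (measurePreserving_appendCoordEquiv (n + 1)).integral_comp
      (appendCoordEquiv (n + 1)).measurableEmbedding]
    refine (integral_prod _ hi).trans ?_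
    refine integral_congr_ae (Filter.Eventually.of_forall fun x => ?_)
    simp only [Function.comp, coe_appendCoordEquiv, oscIntegrand_appendCoord]
    rw [integral_const_mul]
  have hHm : AEStronglyMeasurable (fun x => ∫ y, F (x, y)) volume :=
    hFm.stronglyMeasurable.integral_prod_right'.aestronglyMeasurable
  set G : ℝ → ℝ≥0∞ := fun y =>
    ∏ j, eLpNorm (fun x => g j (appendCoord x y)) ((2 * q j : ℕ) : ℝ≥0∞) volume with hGdef
  have hGm : Measurable G := Finset.measurable_prod _ fun j _ =>
    measurable_eLpNorm_slice (hgm j) (Nat.mul_pos two_pos (hq j))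
  have hmem : ∀ᵐ y : ℝ, ∀ j, MemLp (fun x => g j (appendCoord x y)) ((2 * q j : ℕ) : ℝ≥0∞)
      volume := ae_all_iff.2 fun j =>
    ae_memLp_slice (hgm j) (Nat.mul_pos two_pos (hq j)) (hgL j)
  -- On the diagonal the sliced phase is zero and `hslice` says nothing; the diagonal is a null set.
  have hdiag : ∀ᵐ z : ℝ × ℝ ∂(volume.prod volume), z.1 ≠ z.2 := by
    have hms : MeasurableSet {z : ℝ × ℝ | z.1 = z.2} := measurableSet_eq_fun measurable_fst
      measurable_snd
    have := (Measure.measure_prod_null (μ := (volume : Measure ℝ)) (ν := (volume : Measure ℝ))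
      hms).2 (Filter.Eventually.of_forall fun x => by
        have : Prod.mk x ⁻¹' {z : ℝ × ℝ | z.1 = z.2} = {x} := by
          ext y; simp [eq_comm]
        simp [this])
    rw [ae_iff]
    simpa using this
  have hpair : ∫⁻ z : ℝ × ℝ, ‖∫ x, F (x, z.1) * conj (F (x, z.2))‖ₑ ∂(volume.prod volume) ≤
      2 * (∫⁻ t, k t) * ∫⁻ y, G y ^ 2 := by
    refine (lintegral_mono_ae ?_).trans (lintegral_convolution_form_le hk hGm)
    filter_upwards [hdiag, Measure.quasiMeasurePreserving_fst.ae hmem,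
      Measure.quasiMeasurePreserving_snd.ae hmem] with z hz h1 h2
    have hprod : ∀ j, MemLp (fun x => g j (appendCoord x z.1) * conj (g j (appendCoord x z.2)))
        (q j) volume := fun j => (h1 j).mul_conj (h2 j)
    have hb := hslice z.1 z.2 hz hprod
    have he : oscForm lam (fun x => S (appendCoord x z.1) - S (appendCoord x z.2))
        (fun x => ψ (appendCoord x z.1) * conj (ψ (appendCoord x z.2)))
        (fun (j : Fin (n + 1)) x => f j.castSucc (appendCoord x z.1) *
          conj (f j.castSucc (appendCoord x z.2))) = ∫ x, F (x, z.1) * conj (F (x, z.2)) :=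
      integral_congr_ae (Filter.Eventually.of_forall fun x =>
        oscIntegrand_slice lam S ψ g x z.1 z.2)
    rw [he] at hb
    refine hb.trans ?_
    rw [hGdef, ← Finset.prod_mul_distrib]
    gcongr with j
    exact eLpNorm_mul_conj_le (h1 j) (h2 j)
  have hH2 : eLpNorm (fun x => ∫ y, F (x, y)) 2 volume ≤ (2 * ∫⁻ t, k t) ^ (1 / 2 : ℝ) *
      ∏ j, eLpNorm (g j) ((2 * q j : ℕ) : ℝ≥0∞) volume := by
    have h1 := eLpNorm_natCast_eq (ν := volume) (fun x => ∫ y, F (x, y)) two_pos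
    rw [Nat.cast_ofNat] at h1
    rw [h1]
    calc _ ≤ (2 * (∫⁻ t, k t) *
          (∏ j, eLpNorm (g j) ((2 * q j : ℕ) : ℝ≥0∞) volume) ^ 2) ^ ((2 : ℝ)⁻¹) := by
          simp only [Nat.cast_ofNat]
          refine ENNReal.rpow_le_rpow ?_ (by norm_num)
          refine (lintegral_enorm_integral_sq_le hint).trans (hpair.trans ?_)
          gcongr
          exact lintegral_prod_eLpNorm_slice_sq_le hq (sum_inv_offDiagExponent n) hgm
      _ = _ := by
          rw [ENNReal.mul_rpow_of_nonneg _ _ (by norm_num), ← ENNReal.rpow_natCast _ 2,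
            ← ENNReal.rpow_mul]
          norm_num
  rw [hosc, Fin.prod_univ_castSucc]
  simp only [hpq, offDiagExponent_last]
  have hlast : MemLp (f (Fin.last (n + 1))) 2 volume := by
    simpa only [offDiagExponent_last, Nat.cast_ofNat] using hL (Fin.last (n + 1))
  have hCS : eLpNorm (f (Fin.last (n + 1)) • fun x => ∫ y, F (x, y)) 1 volume ≤
      eLpNorm (f (Fin.last (n + 1))) 2 volume * eLpNorm (fun x => ∫ y, F (x, y)) 2 volume :=
    eLpNorm_smul_le_mul_eLpNorm hHm hlast.1
  rw [eLpNorm_one_eq_lintegral_enorm] at hCS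
  refine (enorm_integral_le_lintegral_enorm _).trans (hCS.trans ?_)
  rw [← mul_assoc, mul_comm]
  exact mul_le_mul' hH2 (by simp)

end CauchySchwarz

/-! ### The one-dimensional oscillatory integral -/

section OneDimensional

/-- Van der Corput's estimate by two integrations by parts, for a phase `φ` with derivatives
`p, p₁, p₂` and an amplitude `u` with derivatives `u₁, u₂`, supported in a closed set `T`. -/
theorem sq_mul_norm_integral_exp_mul_le {φ p p₁ p₂ : ℝ → ℝ} {u u₁ u₂ : ℝ → ℂ} {T : Set ℝ}
    (hT : IsClosed T) {α w μ C₁ C₂ lam : ℝ} (hw : 0 < w) (hμ : 0 < μ)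
    (hC₁ : 0 ≤ C₁) (hC₂ : 0 ≤ C₂) (hTI : T ⊆ Set.Icc α (α + w))
    (hcont : Continuous fun t => Complex.exp (Complex.I * lam * φ t) * u t)
    (hφ : ∀ t ∈ T, HasDerivAt φ (p t) t) (hp : ∀ t ∈ T, HasDerivAt p (p₁ t) t)
    (hp₁ : ∀ t ∈ T, HasDerivAt p₁ (p₂ t) t) (hu : ∀ t, HasDerivAt u (u₁ t) t)
    (hu₁ : ∀ t, HasDerivAt u₁ (u₂ t) t) (zu : ∀ t ∉ T, u t = 0) (zu₁ : ∀ t ∉ T, u₁ t = 0)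
    (zu₂ : ∀ t ∉ T, u₂ t = 0) (bp : ∀ t ∈ T, μ ≤ |p t|) (bp₁ : ∀ t ∈ T, |p₁ t| ≤ C₂ * μ / w)
    (bp₂ : ∀ t ∈ T, |p₂ t| ≤ C₂ * μ / w ^ 2) (bu : ∀ t, ‖u t‖ ≤ C₁)
    (bu₁ : ∀ t, ‖u₁ t‖ ≤ C₁ / w) (bu₂ : ∀ t, ‖u₂ t‖ ≤ C₁ / w ^ 2) :
    lam ^ 2 * ‖∫ t, Complex.exp (Complex.I * lam * φ t) * u t‖ ≤
      C₁ * (1 + 4 * C₂ + 3 * C₂ ^ 2) / (μ ^ 2 * w ^ 2) * w := by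
  set e : ℝ → ℂ := fun t => Complex.exp (Complex.I * lam * φ t) with he
  set r : ℝ → ℂ := fun t => ((p t : ℝ) : ℂ)⁻¹ with hr
  -- With $r=1/p$, $v=((ur)'r)'$ is the amplitude left by two integrations by parts. The function
  -- $F=e\,(i\lambda ur-(ur)'r)$ collects both boundary terms, so that $F'=-\lambda^2eu-ev$ and
  -- $\int F'=0$.
  set v : ℝ → ℂ := fun t => u₂ t * r t ^ 2 - 3 * u₁ t * p₁ t * r t ^ 3 - u t * p₂ t * r t ^ 3 +
    3 * u t * p₁ t ^ 2 * r t ^ 4 with hv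
  set F : ℝ → ℂ := fun t => e t * (Complex.I * lam * u t * r t - u₁ t * r t ^ 2 +
    u t * p₁ t * r t ^ 3) with hF
  -- The four terms of $v$ contribute $1$, $3C_2$, $C_2$ and $3C_2^2$.
  set B := C₁ * (1 + 4 * C₂ + 3 * C₂ ^ 2) / (μ ^ 2 * w ^ 2) with hB
  have hB0 : 0 ≤ B := by positivity
  have hen : ∀ t, ‖e t‖ = 1 := fun t => norm_exp_I_mul lam (φ t)
  have hder : ∀ t, HasDerivAt F (-(lam ^ 2 * (e t * u t)) - e t * v t) t := by
    intro t
    by_cases ht : t ∈ T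
    · have hp0 : ((p t : ℝ) : ℂ) ≠ 0 := by
        have := (hμ.trans_le (bp t ht)).ne'
        exact_mod_cast abs_ne_zero.1 this
      have hpr : (p t : ℂ) * r t = 1 := mul_inv_cancel₀ hp0
      have de : HasDerivAt e (e t * (Complex.I * lam * p t)) t :=
        ((hφ t ht).ofReal_comp.const_mul (Complex.I * lam)).cexp
      have dr : HasDerivAt r (-(p₁ t * r t ^ 2)) t := by
        refine ((hp t ht).ofReal_comp.fun_inv hp0).congr_deriv ?_
        rw [inv_pow, neg_div, div_eq_mul_inv]
      refine (de.fun_mul (((((hu t).const_mul (Complex.I * lam)).fun_mul dr).fun_sub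
        ((hu₁ t).fun_mul (dr.fun_pow 2))).fun_add
        (((hu t).fun_mul (hp₁ t ht).ofReal_comp).fun_mul (dr.fun_pow 3)))).congr_deriv ?_
      simp only [hv]
      push_cast
      linear_combination (e t * (lam ^ 2 * u t * Complex.I ^ 2 - Complex.I * lam * u₁ t * r t +
        Complex.I * lam * u t * p₁ t * r t ^ 2)) * hpr + lam ^ 2 * u t * e t * Complex.I_sq
    · have h0 : -(lam ^ 2 * (e t * u t)) - e t * v t = 0 := by
        simp [hv, zu t ht, zu₁ t ht, zu₂ t ht]
      rw [h0]
      refine (hasDerivAt_const t (0 : ℂ)).congr_of_eventuallyEq ?_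
      filter_upwards [hT.isOpen_compl.mem_nhds ht] with s hs
      simp [hF, zu s hs, zu₁ s hs]
  have hvb : ∀ t, ‖e t * v t‖ ≤ B := by
    intro t
    rw [norm_mul, hen, one_mul]
    by_cases ht : t ∈ T
    · have hrb : ‖r t‖ ≤ μ⁻¹ := by
        rw [hr, norm_inv, Complex.norm_real, Real.norm_eq_abs]
        exact inv_anti₀ hμ (bp t ht)
      have n₁ : ‖(p₁ t : ℂ)‖ ≤ C₂ * μ / w := by simpa using bp₁ t ht
      have n₂ : ‖(p₂ t : ℂ)‖ ≤ C₂ * μ / w ^ 2 := by simpa using bp₂ t ht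
      calc ‖v t‖ ≤ ‖u₂ t * r t ^ 2‖ + ‖3 * u₁ t * p₁ t * r t ^ 3‖ + ‖u t * p₂ t * r t ^ 3‖ +
            ‖3 * u t * p₁ t ^ 2 * r t ^ 4‖ :=
            (norm_add_le _ _).trans (add_le_add ((norm_sub_le _ _).trans
              (add_le_add (norm_sub_le _ _) le_rfl)) le_rfl)
        _ ≤ C₁ / w ^ 2 * μ⁻¹ ^ 2 + 3 * (C₁ / w) * (C₂ * μ / w) * μ⁻¹ ^ 3 +
            C₁ * (C₂ * μ / w ^ 2) * μ⁻¹ ^ 3 + 3 * C₁ * (C₂ * μ / w) ^ 2 * μ⁻¹ ^ 4 := by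
            simp only [norm_mul, norm_pow, Complex.norm_ofNat]
            gcongr
            · exact bu₂ t
            · exact bu₁ t
            · exact bu t
            · exact bu t
        _ = B := by rw [hB]; field_simp; ring
    · simpa [hv, zu t ht, zu₁ t ht, zu₂ t ht] using hB0
  have hout : ∀ t ∉ Set.Icc α (α + w), t ∉ T := fun t ht h => ht (hTI h)
  have iu : Integrable (fun t => e t * u t) := by
    refine hcont.integrable_of_hasCompactSupport
      (HasCompactSupport.intro (isCompact_Icc (a := α) (b := α + w)) fun t ht => ?_)
    simp [zu t (hout t ht)]
  have iF : Integrable F := by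
    have hFc : Continuous F := continuous_iff_continuousAt.2 fun t => (hder t).continuousAt
    refine hFc.integrable_of_hasCompactSupport
      (HasCompactSupport.intro (isCompact_Icc (a := α) (b := α + w)) fun t ht => ?_)
    simp [hF, zu t (hout t ht), zu₁ t (hout t ht)]
  -- Nothing is assumed about the measurability of `u₂` and `p₂`, so $ev$ is recovered from $F'$, a
  -- derivative being measurable.
  have hm : AEStronglyMeasurable (fun t => e t * v t) volume := by
    have h1 : (fun t => e t * v t) = fun t => -deriv F t - lam ^ 2 * (e t * u t) := by
      funext t
      rw [(hder t).deriv]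
      ring
    rw [h1]
    exact (measurable_deriv F).neg.aestronglyMeasurable.sub (iu.const_mul _).1
  have zv : ∀ t ∉ Set.Icc α (α + w), e t * v t = 0 := fun t ht => by
    simp [hv, zu t (hout t ht), zu₁ t (hout t ht), zu₂ t (hout t ht)]
  have iv : Integrable (fun t => e t * v t) := by
    rw [← integrableOn_iff_integrable_of_support_subset
      (s := Set.Icc α (α + w)) (fun t ht => by by_contra h; exact ht (zv t h))]
    exact Measure.integrableOn_of_bounded (by simp) hm
      (Filter.Eventually.of_forall hvb)
  have hzero := integral_eq_zero_of_hasDerivAt_of_integrable hder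
    ((iu.const_mul _).neg.sub iv) iF
  have hsum : ((lam ^ 2 : ℝ) : ℂ) * ∫ t, e t * u t = -∫ t, e t * v t := by
    have iu' : Integrable fun t => -((lam : ℂ) ^ 2 * (e t * u t)) := (iu.const_mul _).neg
    rw [integral_sub iu' iv, integral_neg, integral_const_mul] at hzero
    push_cast
    linear_combination -hzero
  calc lam ^ 2 * ‖∫ t, e t * u t‖ = ‖∫ t in Set.Icc α (α + w), e t * v t‖ := by
        rw [setIntegral_eq_integral_of_forall_compl_eq_zero zv, ← norm_neg (∫ t, e t * v t),
          ← hsum, norm_mul, Complex.norm_real, Real.norm_of_nonneg (by positivity)]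
    _ ≤ B * volume.real (Set.Icc α (α + w)) :=
        norm_setIntegral_le_of_norm_le_const (by simp) fun t _ => hvb t
    _ = B * w := by rw [Real.volume_real_Icc_of_le (by linarith)]; ring

theorem hasDerivAt_finOne (t : ℝ) :
    HasDerivAt (fun s : ℝ => (fun _ : Fin 1 => s)) (Pi.single 0 (1 : ℝ)) t := by
  rw [hasDerivAt_pi]
  intro i
  rw [Subsingleton.elim i 0, Pi.single_eq_same]
  exact hasDerivAt_id' t

/-- With $s=|\lambda|\mu b_0$ and $A=C_1(1+4C_2+3C_2^2)$, the trivial bound gives $N\le Ab_0$ and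
integration by parts gives $s^2N\le Ab_0$. Their sum is a bound integrable in $s$. -/
theorem IsLocalDatum.norm_integral_amplitude_le {S : (Fin 1 → ℝ) → ℝ} {ψ : (Fin 1 → ℝ) → ℂ}
    {a b : Fin 1 → ℝ} {μ C₁ C₂ : ℝ} (h : IsLocalDatum S ψ a b μ C₁ C₂) (hμ : 0 < μ)
    (hb : 0 < b 0) (hC₂ : 0 ≤ C₂) (lam : ℝ) :
    ‖∫ x, Complex.exp (Complex.I * lam * S x) * ψ x‖ ≤
      2 * (C₁ * (1 + 4 * C₂ + 3 * C₂ ^ 2)) * b 0 * (1 + (|lam| * μ * b 0) ^ 2)⁻¹ := by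
  have hC₁ : 0 ≤ C₁ := (norm_nonneg _).trans (h.norm_cutoff_le 0)
  obtain ⟨U, hU, hKU, hS⟩ := h.smooth_phase
  set c : ℝ → Fin 1 → ℝ := fun t _ => t with hc
  have hcc : Continuous c := continuous_pi fun _ => continuous_id
  have hI : ∫ x, Complex.exp (Complex.I * lam * S x) * ψ x =
      ∫ t : ℝ, Complex.exp (Complex.I * lam * S (c t)) * ψ (c t) := by
    exact (((volume_preserving_funUnique (Fin 1) ℝ).symm _).integral_comp
      (MeasurableEquiv.measurableEmbedding _)
      fun x => Complex.exp (Complex.I * lam * S x) * ψ x).symm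
  rw [hI]
  set A := C₁ * (1 + 4 * C₂ + 3 * C₂ ^ 2) with hA
  have hTU : ∀ t ∈ c ⁻¹' tsupport ψ, c t ∈ U := fun t ht => hKU (subset_convexHull ℝ _ ht)
  have hmix : mixedDeriv S = partialDeriv 0 S := by simp [mixedDeriv, List.finRange_succ]
  have hd : ∀ g : (Fin 1 → ℝ) → ℝ, ContDiffOn ℝ ∞ g U → ∀ t ∈ c ⁻¹' tsupport ψ,
      HasDerivAt (fun s => g (c s)) (partialDeriv 0 g (c t)) t := fun g hg t ht =>
    hasDerivAt_comp_partialDeriv (c := c)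
      ((hg.differentiableOn (by simp)).differentiableAt (hU.mem_nhds (hTU t ht)))
      (hasDerivAt_finOne t)
  have hdψ : ∀ g : (Fin 1 → ℝ) → ℂ, ContDiff ℝ ∞ g → ∀ t,
      HasDerivAt (fun s => g (c s)) (partialDeriv 0 g (c t)) t := fun g hg t =>
    hasDerivAt_comp_partialDeriv (c := c) (hg.differentiable (by simp) _) (hasDerivAt_finOne t)
  have hz : Set.EqOn ψ (fun _ => 0) (tsupport ψ)ᶜ := fun x hx =>
    image_eq_zero_of_notMem_tsupport hx
  have hzd : partialDeriv (0 : Fin 1) (fun _ : Fin 1 → ℝ => (0 : ℂ)) = fun _ => 0 := by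
    funext x
    simp [partialDeriv, lineDeriv]
  have ho : IsOpen (tsupport ψ)ᶜ := (isClosed_tsupport ψ).isOpen_compl
  have hz₁ : Set.EqOn (partialDeriv 0 ψ) (fun _ => 0) (tsupport ψ)ᶜ := by
    simpa only [hzd] using partialDeriv_eqOn ho hz 0
  have hz₂ : Set.EqOn (partialDeriv 0 (partialDeriv 0 ψ)) (fun _ => 0) (tsupport ψ)ᶜ := by
    simpa only [hzd] using partialDeriv_eqOn ho hz₁ 0
  have hbox : c ⁻¹' tsupport ψ ⊆ Set.Icc (a 0) (a 0 + b 0) := fun t ht =>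
    ⟨(h.tsupport_subset ht).1 0, (h.tsupport_subset ht).2 0⟩
  have hcont := (h.continuous_amplitude lam).comp hcc
  have h1 := sq_mul_norm_integral_exp_mul_le ((isClosed_tsupport ψ).preimage hcc) hb hμ hC₁ hC₂
    (lam := lam) hbox hcont (hd S hS) (hd _ (hS.partialDeriv hU 0))
    (hd _ ((hS.partialDeriv hU 0).partialDeriv hU 0)) (hdψ ψ h.smooth_cutoff)
    (hdψ _ (h.smooth_cutoff.partialDeriv 0)) (fun t ht => hz ht) (fun t ht => hz₁ ht)
    (fun t ht => hz₂ ht)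
    (fun t ht => hmix ▸ h.est.phase_lower _ (subset_convexHull ℝ _ ht))
    (fun t ht => hmix ▸ h.est.phase_first _ (subset_convexHull ℝ _ ht))
    (fun t ht => hmix ▸ h.est.phase_second _ (subset_convexHull ℝ _ ht))
    (fun t => h.norm_cutoff_le _) (fun t => by simpa using h.est.cutoff 1 (by norm_num) (c t))
    (fun t => by simpa using h.est.cutoff 2 le_rfl (c t))
  set N := ‖∫ t : ℝ, Complex.exp (Complex.I * lam * S (c t)) * ψ (c t)‖ with hN
  have h2 : N ≤ C₁ * b 0 := by
    have hout : ∀ t ∉ Set.Icc (a 0) (a 0 + b 0),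
        Complex.exp (Complex.I * lam * S (c t)) * ψ (c t) = 0 := fun t ht => by
      rw [hz (fun h' => ht (hbox h')), mul_zero]
    rw [hN, ← setIntegral_eq_integral_of_forall_compl_eq_zero hout]
    refine (norm_setIntegral_le_of_norm_le_const (C := C₁) (by simp) fun t _ => ?_).trans_eq ?_
    · rw [norm_mul, norm_exp_I_mul, one_mul]
      exact h.norm_cutoff_le _
    · rw [Real.volume_real_Icc_of_le (by linarith)]; ring
  have h3 : N ≤ A * b 0 := h2.trans (by
    rw [hA]
    gcongr
    nlinarith [mul_nonneg hC₁ hC₂, mul_nonneg hC₁ (sq_nonneg C₂)])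
  have h4 : (|lam| * μ * b 0) ^ 2 * N ≤ A * b 0 := by
    have : A / (μ ^ 2 * b 0 ^ 2) * b 0 * (μ ^ 2 * b 0 ^ 2) = A * b 0 := by field_simp
    rw [← this, mul_pow, mul_pow, sq_abs]
    have := mul_le_mul_of_nonneg_right h1 (show 0 ≤ μ ^ 2 * b 0 ^ 2 by positivity)
    linarith
  rw [← div_eq_mul_inv, le_div_iff₀ (by positivity)]
  linarith

end OneDimensional

/-! ### Integrals of the convolution kernels -/

section Kernels

theorem lintegral_inv_one_add_mul_sq {A : ℝ} (hA : 0 < A) {M : ℝ} (hM : 0 ≤ M) :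
    ∫⁻ t, ENNReal.ofReal (M * (1 + (A * t) ^ 2)⁻¹) = ENNReal.ofReal (M * Real.pi / A) := by
  have h1 : Integrable fun t : ℝ => (1 + (A * t) ^ 2)⁻¹ :=
    integrable_inv_one_add_sq.comp_mul_left' hA.ne'
  rw [← ofReal_integral_eq_lintegral_ofReal (h1.const_mul M)
    (Filter.Eventually.of_forall fun t => by positivity), integral_const_mul,
    Measure.integral_comp_mul_left (fun t : ℝ => (1 + t ^ 2)⁻¹) A, integral_univ_inv_one_add_sq,
    abs_of_pos (inv_pos.2 hA), smul_eq_mul]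
  congr 1
  field_simp

/-- The kernel `t ↦ t^{-γ}` on `[0, w]`. -/
noncomputable def rieszKernel (γ w : ℝ) : ℝ → ℝ≥0∞ :=
  (Set.Icc 0 w).indicator fun t => ENNReal.ofReal (t ^ (-γ))

theorem measurable_rieszKernel (γ w : ℝ) : Measurable (rieszKernel γ w) :=
  (ENNReal.measurable_ofReal.comp (measurable_id.pow_const _)).indicator measurableSet_Icc

theorem lintegral_rieszKernel {γ w : ℝ} (hγ : γ < 1) (hw : 0 < w) :
    ∫⁻ t, rieszKernel γ w t = ENNReal.ofReal (w ^ (1 - γ) / (1 - γ)) := by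
  rw [rieszKernel, lintegral_indicator measurableSet_Icc, setLIntegral_congr Ioc_ae_eq_Icc.symm]
  have hi : IntervalIntegrable (fun t : ℝ => t ^ (-γ)) volume 0 w :=
    intervalIntegral.intervalIntegrable_rpow' (by linarith)
  rw [← ofReal_integral_eq_lintegral_ofReal ((intervalIntegrable_iff_integrableOn_Ioc_of_le
    hw.le).1 hi) ((ae_restrict_iff' measurableSet_Ioc).2 (Filter.Eventually.of_forall
    fun t ht => Real.rpow_nonneg ht.1.le _)), ← intervalIntegral.integral_of_le hw.le,
    integral_rpow (Or.inl (by linarith)), Real.zero_rpow (by linarith), sub_zero]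
  congr 2 <;> ring_nf

theorem ofReal_abs_rpow_le_rieszKernel {γ w t : ℝ} (ht : |t| ≤ w) :
    ENNReal.ofReal (|t| ^ (-γ)) ≤ rieszKernel γ w t + rieszKernel γ w (-t) := by
  rcases le_total 0 t with h | h
  · rw [abs_of_nonneg h] at ht ⊢
    refine le_add_right ?_
    rw [rieszKernel, Set.indicator_of_mem (Set.mem_Icc.2 ⟨h, ht⟩)]
  · rw [abs_of_nonpos h] at ht ⊢
    refine le_add_left ?_
    rw [rieszKernel, Set.indicator_of_mem (Set.mem_Icc.2 ⟨neg_nonneg.2 h, ht⟩)]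

end Kernels

/-! ### Constants and the induction on dimension -/

theorem IsLocalDatum.enorm_oscForm_le_one {S : (Fin 1 → ℝ) → ℝ} {ψ : (Fin 1 → ℝ) → ℂ}
    {a b : Fin 1 → ℝ} {μ C₁ C₂ : ℝ} (h : IsLocalDatum S ψ a b μ C₁ C₂) (hμ : 0 < μ)
    (hb : 0 < b 0) (hC₂ : 0 ≤ C₂) (lam : ℝ) (f : Fin 1 → (Fin 0 → ℝ) → ℂ) :
    ‖oscForm lam S ψ f‖ₑ ≤
      ENNReal.ofReal (2 * (C₁ * (1 + 4 * C₂ + 3 * C₂ ^ 2)) * b 0 *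
        (1 + (|lam| * μ * b 0) ^ 2)⁻¹) *
      ∏ j, eLpNorm (f j) (offDiagExponent 1 j) volume := by
  have h1 : oscForm lam S ψ f =
      (∫ x, Complex.exp (Complex.I * lam * S x) * ψ x) * f 0 default := by
    rw [oscForm, ← integral_mul_const]
    refine integral_congr_ae (Filter.Eventually.of_forall fun x => ?_)
    simp only [oscIntegrand]
    rw [Fin.prod_univ_one, Subsingleton.elim (forgetCoord 0 x) default]
  have h2 : eLpNorm (f 0) (offDiagExponent 1 0) volume = ‖f 0 default‖ₑ := by
    have h3 : f 0 = fun _ => f 0 default := funext fun x => by rw [Subsingleton.elim x default]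
    rw [eLpNorm_natCast_eq _ (offDiagExponent_pos _ _), h3, volume_pi, Measure.pi_of_empty]
    simp [offDiagExponent]
  rw [h1, enorm_mul, Fin.prod_univ_one, h2]
  gcongr
  rw [← ofReal_norm]
  exact ENNReal.ofReal_le_ofReal (h.norm_integral_amplitude_le hμ hb hC₂ lam)

/-- The constant `C (|λ|μ)^{-2^{-n}} ∏_j b_j^{1/p_j - 2^{-n}}` in dimension `n + 1`. -/
noncomputable def oscConst (n : ℕ) (C s : ℝ) (b : Fin (n + 1) → ℝ) : ℝ :=
  C * s ^ (-((2 : ℝ) ^ n)⁻¹) *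
    ∏ j, b j ^ (1 / (offDiagExponent (n + 1) j : ℝ) - ((2 : ℝ) ^ n)⁻¹)

theorem oscConst_nonneg {n : ℕ} {C s : ℝ} (hC : 0 ≤ C) (hs : 0 ≤ s) {b : Fin (n + 1) → ℝ}
    (hb : ∀ j, 0 ≤ b j) : 0 ≤ oscConst n C s b :=
  mul_nonneg (mul_nonneg hC (Real.rpow_nonneg hs _))
    (Finset.prod_nonneg fun j _ => Real.rpow_nonneg (hb j) _)

theorem oscConst_one (C s : ℝ) {b : Fin 2 → ℝ} : oscConst 1 C s b = C * s ^ (-(1 / 2 : ℝ)) := by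
  simp [oscConst, Fin.prod_univ_two, offDiagExponent]

theorem oscConst_mul {n : ℕ} {C s t : ℝ} (hs : 0 ≤ s) (ht : 0 ≤ t) (b : Fin (n + 1) → ℝ) :
    oscConst n C (s * t) b = oscConst n C s b * t ^ (-((2 : ℝ) ^ n)⁻¹) := by
  rw [oscConst, oscConst, Real.mul_rpow hs ht]
  ring

/-- The square root halves every exponent: with $\gamma=2^{-n}$,
$\frac12(1/q_j-\gamma)=1/(2q_j)-\gamma/2$, and the new side gets $\frac12(1-\gamma)=1/2-\gamma/2$,
matching the last exponent $2$. -/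
theorem oscConst_succ {n : ℕ} {C s : ℝ} (hC : 0 ≤ C) (hs : 0 ≤ s) {b : Fin (n + 2) → ℝ}
    (hb : ∀ j, 0 ≤ b j) :
    (8 * oscConst n C s (fun j => b j.castSucc) *
      b (Fin.last (n + 1)) ^ (1 - ((2 : ℝ) ^ n)⁻¹)) ^ (1 / 2 : ℝ) =
    oscConst (n + 1) ((8 * C) ^ (1 / 2 : ℝ)) s b := by
  have hP : 0 ≤ ∏ j : Fin (n + 1), b j.castSucc ^
      (1 / (offDiagExponent (n + 1) j : ℝ) - ((2 : ℝ) ^ n)⁻¹) :=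
    Finset.prod_nonneg fun j _ => Real.rpow_nonneg (hb _) _
  have hγ : ((2 : ℝ) ^ (n + 1))⁻¹ = ((2 : ℝ) ^ n)⁻¹ * (1 / 2) := by rw [pow_succ, mul_inv]; ring
  have hsr : 0 ≤ s ^ (-((2 : ℝ) ^ n)⁻¹) := Real.rpow_nonneg hs _
  rw [oscConst, oscConst, Fin.prod_univ_castSucc (n := n + 1), offDiagExponent_last, hγ,
    Real.mul_rpow (by positivity) (Real.rpow_nonneg (hb _) _), ← mul_assoc, ← mul_assoc,
    Real.mul_rpow (by positivity) hP, Real.mul_rpow (by positivity) hsr,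
    ← Real.finsetProd_rpow _ _ (fun j _ => Real.rpow_nonneg (hb _) _), ← Real.rpow_mul hs,
    ← Real.rpow_mul (hb _), mul_assoc, mul_assoc, mul_assoc]
  congr 2
  · congr 1; ring
  · congr 1
    · refine Finset.prod_congr rfl fun j _ => ?_
      rw [← Real.rpow_mul (hb _), offDiagExponent_castSucc]
      congr 1
      push_cast
      have : (offDiagExponent (n + 1) j : ℝ) ≠ 0 := by
        exact_mod_cast (offDiagExponent_pos _ _).ne'
      field_simp
    · congr 1; push_cast; ring

/-- Two heights further apart than the box cannot both meet it. This truncates the kernel, which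
would otherwise fail to be integrable at infinity. -/
theorem oscForm_slice_eq_zero {n : ℕ} {S : (Fin (n + 2) → ℝ) → ℝ} {ψ : (Fin (n + 2) → ℝ) → ℂ}
    {a b : Fin (n + 2) → ℝ} {μ C₁ C₂ : ℝ} (h : IsLocalDatum S ψ a b μ C₁ C₂) {y y' : ℝ}
    (hy : b (Fin.last (n + 1)) < |y - y'|) (lam : ℝ) (T : (Fin (n + 1) → ℝ) → ℝ)
    (f : Fin (n + 1) → (Fin n → ℝ) → ℂ) :
    oscForm lam T (fun x => ψ (appendCoord x y) * conj (ψ (appendCoord x y'))) f = 0 := by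
  have h0 : ∀ x : Fin (n + 1) → ℝ,
      ψ (appendCoord x y) * conj (ψ (appendCoord x y')) = 0 := by
    intro x
    by_contra hne
    have h1 : appendCoord x y ∈ Set.Icc a (a + b) := by
      by_contra h'
      exact hne (by rw [h.cutoff_eq_zero h', zero_mul])
    have h2 : appendCoord x y' ∈ Set.Icc a (a + b) := by
      by_contra h'
      exact hne (by rw [h.cutoff_eq_zero h', map_zero, mul_zero])
    have l1 := h1.1 (Fin.last _)
    have u1 := h1.2 (Fin.last _)
    have l2 := h2.1 (Fin.last _)
    have u2 := h2.2 (Fin.last _)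
    simp only [appendCoord_last, Pi.add_apply] at l1 u1 l2 u2
    exact absurd (abs_le.2 ⟨by linarith, by linarith⟩) (not_le.2 hy)
  simp [oscForm, oscIntegrand, h0]

/-- The multilinear estimate for measurable functions. -/
theorem exists_enorm_oscForm_le (n : ℕ) (hn : 1 ≤ n) : ∀ C₁ C₂ : ℝ, 0 < C₁ → 0 < C₂ →
    ∃ C : ℝ, 0 < C ∧ ∀ (μ lam : ℝ) (a b : Fin (n + 1) → ℝ) (S : (Fin (n + 1) → ℝ) → ℝ)
      (ψ : (Fin (n + 1) → ℝ) → ℂ) (f : Fin (n + 1) → (Fin n → ℝ) → ℂ),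
      0 < μ → lam ≠ 0 → (∀ j, 0 < b j) → IsLocalDatum S ψ a b μ C₁ C₂ →
      (∀ j, Measurable (f j)) → (∀ j, MemLp (f j) (offDiagExponent (n + 1) j) volume) →
      ‖oscForm lam S ψ f‖ₑ ≤ ENNReal.ofReal (oscConst n C (|lam| * μ) b) *
        ∏ j, eLpNorm (f j) (offDiagExponent (n + 1) j) volume := by
  induction n, hn using Nat.le_induction with
  | base =>
    intro C₁ C₂ hC₁ hC₂
    -- The one-dimensional constant, evaluated at the cutoff constant $4C_1^2$ of a pair of slices.
    set M := 2 * (4 * C₁ ^ 2 * (1 + 4 * C₂ + 3 * C₂ ^ 2)) with hM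
    have hM0 : 0 < M := by positivity
    refine ⟨(2 * (M * Real.pi)) ^ (1 / 2 : ℝ), by positivity, ?_⟩
    intro μ lam a b S ψ f hμ hlam hb h hf hL
    have hs : 0 < |lam| * μ := mul_pos (abs_pos.2 hlam) hμ
    have h1 := h.enorm_oscForm_le_of_slices lam hf hL
      (k := fun t => ENNReal.ofReal (M * b 0 * (1 + (|lam| * μ * b 0 * t) ^ 2)⁻¹))
      (by fun_prop) fun y y' hy _ => by
        have h2 := (h.slice (hb 0) hy).enorm_oscForm_le_one
          (mul_pos hμ (abs_pos.2 (sub_ne_zero.2 hy))) (hb 0) hC₂.le lam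
          (fun (j : Fin 1) x => f j.castSucc (appendCoord x y) *
            conj (f j.castSucc (appendCoord x y')))
        refine h2.trans_eq ?_
        congr 4
        simp only [Fin.castSucc_zero]
        rw [show |lam| * (μ * |y - y'|) * b 0 = |lam| * μ * b 0 * |y - y'| by ring, mul_pow,
          sq_abs, ← mul_pow]
    refine h1.trans_eq ?_
    congr 1
    -- The factor $b_0$ cancels on integrating the kernel, in agreement with the zero exponents of
    -- both sides when $d=2$.
    rw [lintegral_inv_one_add_mul_sq (mul_pos hs (hb 0)) (by have := hb 0; positivity),
      oscConst_one, show (2 : ℝ≥0∞) = ENNReal.ofReal 2 by simp, ← ENNReal.ofReal_mul (by norm_num),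
      ENNReal.ofReal_rpow_of_nonneg (by have := hb 0; positivity) (by norm_num)]
    congr 1
    have hb0 := (hb 0).ne'
    rw [show 2 * (M * b 0 * Real.pi / (|lam| * μ * b 0)) = 2 * (M * Real.pi) * (|lam| * μ)⁻¹ by
      field_simp, Real.mul_rpow (by positivity) (by positivity), Real.inv_rpow hs.le,
      Real.rpow_neg hs.le]
  | succ n hn ih =>
    intro C₁ C₂ hC₁ hC₂
    obtain ⟨C, hC, hbound⟩ := ih (4 * C₁ ^ 2) C₂ (by positivity) hC₂
    refine ⟨(8 * C) ^ (1 / 2 : ℝ), by positivity, ?_⟩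
    intro μ lam a b S ψ f hμ hlam hb h hf hL
    have hs : 0 < |lam| * μ := mul_pos (abs_pos.2 hlam) hμ
    set γ := ((2 : ℝ) ^ n)⁻¹ with hγ
    set w := b (Fin.last (n + 1)) with hw
    have hw0 : 0 < w := hb _
    -- Since $n\ge1$, $1/(1-\gamma)\le2$. Together with the two halves of the kernel and the factor
    -- $2$ from Schur's test, this accounts for the $8$ in the constant.
    have hγ2 : γ ≤ 1 / 2 := by
      rw [hγ, one_div]
      exact inv_anti₀ (by norm_num) (le_self_pow₀ (by norm_num) (by omega))
    set A := oscConst n C (|lam| * μ) (fun j => b j.castSucc) with hA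
    have hA0 : 0 ≤ A := oscConst_nonneg hC.le hs.le fun j => (hb _).le
    have hkm := measurable_rieszKernel γ w
    have hkm' : Measurable fun t => rieszKernel γ w t + rieszKernel γ w (-t) :=
      hkm.add (hkm.comp measurable_neg)
    have h1 := h.enorm_oscForm_le_of_slices lam hf hL
      (k := fun t => ENNReal.ofReal A * (rieszKernel γ w t + rieszKernel γ w (-t)))
      (hkm'.const_mul _) fun y y' hy hmem => by
        rcases lt_or_ge w |y - y'| with hlt | hle
        · rw [oscForm_slice_eq_zero h hlt]
          simp
        · refine (hbound (μ * |y - y'|) lam _ _ _ _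
            (fun j x => f j.castSucc (appendCoord x y) * conj (f j.castSucc (appendCoord x y')))
            (mul_pos hμ (abs_pos.2 (sub_ne_zero.2 hy))) hlam (fun j => hb _) (h.slice (hb 0) hy)
            (fun j => ((hf _).comp (measurable_appendCoord_left y)).mul
              (Complex.continuous_conj.measurable.comp
                ((hf _).comp (measurable_appendCoord_left y')))) hmem).trans ?_
          rw [← mul_assoc, oscConst_mul hs.le (abs_nonneg _), ENNReal.ofReal_mul hA0]
          gcongr
          exact ofReal_abs_rpow_le_rieszKernel hle
    refine h1.trans ?_
    gcongr
    rw [← oscConst_succ hC.le hs.le (fun j => (hb j).le), lintegral_const_mul _ hkm',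
      lintegral_add_left hkm, lintegral_neg_eq_self
      (rieszKernel γ w), lintegral_rieszKernel (by linarith) hw0, ← ENNReal.ofReal_rpow_of_nonneg
      (by positivity) (by norm_num)]
    refine ENNReal.rpow_le_rpow ?_ (by norm_num)
    have hq : 0 ≤ w ^ (1 - γ) / (1 - γ) := div_nonneg (Real.rpow_nonneg hw0.le _) (by linarith)
    rw [← ENNReal.ofReal_add hq hq, ← ENNReal.ofReal_mul hA0,
      show (2 : ℝ≥0∞) = ENNReal.ofReal 2 by simp, ← ENNReal.ofReal_mul (by norm_num)]
    refine ENNReal.ofReal_le_ofReal ?_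
    have h2 : w ^ (1 - γ) / (1 - γ) ≤ 2 * w ^ (1 - γ) := by
      rw [div_le_iff₀ (by linarith)]
      nlinarith [Real.rpow_nonneg hw0.le (1 - γ)]
    calc 2 * (A * (w ^ (1 - γ) / (1 - γ) + w ^ (1 - γ) / (1 - γ)))
        ≤ 2 * (A * (2 * w ^ (1 - γ) + 2 * w ^ (1 - γ))) := by gcongr
      _ = 8 * A * w ^ (1 - γ) := by ring

theorem mainTheorem4 (n : ℕ) (hn : 1 ≤ n) (C₁ C₂ : ℝ) (hC₁ : 0 < C₁) (hC₂ : 0 < C₂) :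
    ∃ C : ℝ, 0 < C ∧
      ∀ (μ lam : ℝ) (a b : Fin (n + 1) → ℝ) (U : Set (Fin (n + 1) → ℝ))
        (S : (Fin (n + 1) → ℝ) → ℝ) (ψ : (Fin (n + 1) → ℝ) → ℂ)
        (f : Fin (n + 1) → (Fin n → ℝ) → ℂ),
        0 < μ → lam ≠ 0 → (∀ j, 0 < b j) →
        ContDiff ℝ ∞ ψ →
        tsupport ψ ⊆ Set.Icc a (a + b) →
        IsOpen U → convexHull ℝ (tsupport ψ) ⊆ U → ContDiffOn ℝ ∞ S U →
        LocalEstimateHypotheses S ψ 0 (b 0) μ C₁ C₂ →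
        (∀ j, MemLp (f j) (offDiagExponent (n + 1) j) volume) →
        Integrable (oscIntegrand lam S ψ f) volume ∧
        ‖oscForm lam S ψ f‖ ≤
          C * (|lam| * μ) ^ (-(2 : ℝ) ^ (1 - ((n + 1 : ℕ) : ℝ))) *
            ∏ j, (b j ^ (1 / (offDiagExponent (n + 1) j : ℝ) - (2 : ℝ) ^ (1 - ((n + 1 : ℕ) : ℝ))) *
              (eLpNorm (f j) (offDiagExponent (n + 1) j) volume).toReal) := by
  obtain ⟨C, hC, hbound⟩ := exists_enorm_oscForm_le n hn C₁ C₂ hC₁ hC₂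
  refine ⟨C, hC, ?_⟩
  intro μ lam a b U S ψ f hμ hlam hb hψ hbox hU hKU hS hest hL
  have h : IsLocalDatum S ψ a b μ C₁ C₂ := ⟨hψ, hbox, ⟨U, hU, hKU, hS⟩, hest⟩
  refine ⟨h.integrable_oscIntegrand lam hL, ?_⟩
  -- Slicing at a fixed height requires genuinely measurable functions. Passing to representatives
  -- does not change the form, because preimages of null sets under the coordinate projections are
  -- null.
  set g : Fin (n + 1) → (Fin n → ℝ) → ℂ := fun j => (hL j).1.mk (f j) with hg
  have hfg : ∀ j, f j =ᵐ[volume] g j := fun j => (hL j).1.ae_eq_mk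
  have hgm : ∀ j, Measurable (g j) := fun j => (hL j).1.stronglyMeasurable_mk.measurable
  have hgL : ∀ j, MemLp (g j) (offDiagExponent (n + 1) j) volume := fun j =>
    (memLp_congr_ae (hfg j)).1 (hL j)
  have hosc : oscForm lam S ψ f = oscForm lam S ψ g := by
    refine integral_congr_ae ?_
    have h1 : ∀ᵐ x : Fin (n + 1) → ℝ, ∀ j, f j (forgetCoord j x) = g j (forgetCoord j x) :=
      ae_all_iff.2 fun j => (quasiMeasurePreserving_forgetCoord j).ae (hfg j)
    filter_upwards [h1] with x hx
    simp only [oscIntegrand, hx]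
  have hb1 := hbound μ lam a b S ψ g hμ hlam hb h hgm hgL
  rw [← hosc] at hb1
  simp only [← eLpNorm_congr_ae (hfg _)] at hb1
  have hγ : (2 : ℝ) ^ (1 - ((n + 1 : ℕ) : ℝ)) = ((2 : ℝ) ^ n)⁻¹ := by
    rw [show 1 - ((n + 1 : ℕ) : ℝ) = -(n : ℝ) by push_cast; ring, Real.rpow_neg (by norm_num),
      Real.rpow_natCast]
  have hfin : ENNReal.ofReal (oscConst n C (|lam| * μ) b) *
      ∏ j, eLpNorm (f j) (offDiagExponent (n + 1) j) volume ≠ ⊤ :=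
    ENNReal.mul_ne_top ENNReal.ofReal_ne_top (ENNReal.prod_ne_top fun j _ => (hL j).2.ne)
  have hb2 := ENNReal.toReal_mono hfin hb1
  rw [toReal_enorm, ENNReal.toReal_mul, ENNReal.toReal_prod, ENNReal.toReal_ofReal
    (oscConst_nonneg hC.le (by positivity) fun j => (hb j).le)] at hb2
  refine hb2.trans_eq ?_
  rw [oscConst, hγ, Finset.prod_mul_distrib, mul_assoc]
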